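/- Let $W_1,W_2,\dots$ be independent random elements with common law $\nu$, let $\mathsf h(w,\theta)$, $\theta\in\mathbb R^d$, be differentiable in $\theta$ and $\nu$-integrable in $w$, and put $\mathsf H(w,\theta)=\nabla_\theta\mathsf h(w,\theta)$, $\bar{\mathsf H}(\theta)=\mathbb E_W[\mathsf H(W,\theta)]$. Assume: $\mathsf H$ is jointly measurable, $\mathbb E_W\|\mathsf H(W,\theta)\|^2<\infty$ for every $\theta$, and $\mathbb E_W\|\mathsf H(W,\theta)-\mathsf H(W,\theta')\|^2\le L^2\|\theta-\theta'\|^2$ for all $\theta,\theta'$; $\theta_*$ is a local minimizer of $\theta\mapsto\mathbb E_W[\mathsf h(W,\theta)]$, $\bar{\mathsf H}$ is $C^1$ near $\theta_*$, and $\theta_*$ is globally attracting: $\langle\bar{\mathsf H}(\theta),\theta-\theta_*\rangle\ge m\|\theta-\theta_*\|^2$ for all $\theta$, for some $m>0$. Let $C$ be the Jacobian of $\bar{\mathsf H}$ at $\theta_*$ (the Hessian of $\mathbb E_W[\mathsf h(W,\theta)]$). For $K\ge1$ and $\mu'>0$ consider, both started at a point $\theta_0$, the classical algorithm with step $\mu=\mu'/K$,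 $\theta_t=\theta_{t-1}-\mu\,\mathsf H(W_t,\theta_{t-1})$, and the batch algorithm $\theta'_{nK}=\theta'_{(n-1)K}-\frac{\mu'}{K}\sum_{j=0}^{K-1}\mathsf H(W_{nK-j},\theta'_{(n-1)K})$. The average trajectory of a recursion $x_t=x_{t-1}-\mu\,G_t(x_{t-1})$ with random update directions $G_t$ is $\bar x_t=\bar x_{t-1}-\mu\,\mathbb E[G_t](\bar x_{t-1})$, $\bar x_0=x_0$, where $\mathbb E[G_t](x)=\mathbb E[G_t(x)]$ for fixed $x$; put $v_t=\theta_t-\bar\theta_t$ and $v'_{nK}=\theta'_{nK}-\bar\theta'_{nK}$. All these random vectors have finite second moments, and the following holds. 1. For all $n\ge1$, $$\bar\theta'_{nK}=\bar\theta'_{(n-1)K}-\mu'\bar{\mathsf H}(\bar\theta'_{(n-1)K}),\qquad \bar\theta_{nK}=\bar\theta_{(n-1)K}-\mu'\,(I+A)\,\bar{\mathsf H}(\bar\theta_{(n-1)K}),$$ where $A$ is a $d\times d$ matrix (depending on $n,\mu',K,\theta_0$) with $\|A\|\le c\,\mu'$ for $0<\mu'\le1$, the constant $c$ depending on none of $n,\mu',K,\theta_0$.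 2. The Lyapunov equation $CQ+QC^{\intercal}=\mathbb E_W[\mathsf H(W,\theta_*)\mathsf H(W,\theta_*)^{\intercal}]$ has exactly one solution $Q$. For every $K\ge 1$ and all sufficiently small $\mu'>0$ the limits $\mathbb E[v_\infty v_\infty^{\intercal}]=\lim_{t\to\infty}\mathbb E[v_tv_t^{\intercal}]$ and $\mathbb E[v'_\infty (v'_\infty)^{\intercal}]=\lim_{n\to\infty}\mathbb E[v'_{nK}(v'_{nK})^{\intercal}]$ exist and do not depend on $\theta_0$, and both are equal to $\frac{\mu'}{K}\big(Q+o(1)\big)$ as $\mu'\to0^+$. -/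

import Mathlib

open MeasureTheory ProbabilityTheory Filter Topology

noncomputable section

section Recursions

variable {Ω 𝓦 E : Type*} [NormedAddCommGroup E] [NormedSpace ℝ E]

/-- The stochastic recursion `θ_t = θ_{t-1} - μ G_t(θ_{t-1})`, started at `θ₀`, where
`G t ω` is the (random) update direction used at time `t ≥ 1`. -/
def stochTraj (G : ℕ → Ω → E → E) (μ : ℝ) (θ₀ : E) : ℕ → Ω → E
  | 0, _ => θ₀
  | t + 1, ω => stochTraj G μ θ₀ t ω - μ • G (t + 1) ω (stochTraj G μ θ₀ t ω)

/-- The average trajectory of `stochTraj`: the deterministic recursion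
`θ̄_t = θ̄_{t-1} - μ 𝔼[G_t(θ̄_{t-1})]`, started at the same point `θ₀`. -/
def avgTraj [MeasurableSpace Ω] (P : Measure Ω) (G : ℕ → Ω → E → E) (μ : ℝ) (θ₀ : E) : ℕ → E
  | 0 => θ₀
  | t + 1 => avgTraj P G μ θ₀ t - μ • ∫ ω, G (t + 1) ω (avgTraj P G μ θ₀ t) ∂P

/-- The random perturbation `v_t = θ_t - θ̄_t` around the average trajectory. -/
def perturbation [MeasurableSpace Ω] (P : Measure Ω) (G : ℕ → Ω → E → E) (μ : ℝ) (θ₀ : E)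
    (t : ℕ) (ω : Ω) : E :=
  stochTraj G μ θ₀ t ω - avgTraj P G μ θ₀ t

/-- Update direction of the classical one-sample algorithm: `H(W_t, θ)`. -/
def classicalDir (H : 𝓦 → E → E) (W : ℕ → Ω → 𝓦) (t : ℕ) (ω : Ω) (θ : E) : E :=
  H (W t ω) θ

/-- Update direction of the batch algorithm, `(1/K) ∑_{j=0}^{K-1} H(W_{nK-j}, θ)`; it is used for
`n ≥ 1` only, where it involves the batch `W_{(n-1)K+1}, …, W_{nK}`. -/
def batchDir (H : 𝓦 → E → E) (W : ℕ → Ω → 𝓦) (K : ℕ) (n : ℕ) (ω : Ω) (θ : E) : E :=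
  (K : ℝ)⁻¹ • ∑ j ∈ Finset.range K, H (W (n * K - j) ω) θ

end Recursions

/-- The matrix `𝔼[v vᵀ]` of a random vector `v`. -/
def secondMoment {Ω : Type*} [MeasurableSpace Ω] {d : ℕ} (P : Measure Ω)
    (v : Ω → EuclideanSpace ℝ (Fin d)) : Matrix (Fin d) (Fin d) ℝ :=
  Matrix.of fun i j => ∫ ω, v ω i * v ω j ∂P

/-- The Jacobian matrix of `g` at `θ`. -/
def jacobianMatrix {d : ℕ} (g : EuclideanSpace ℝ (Fin d) → EuclideanSpace ℝ (Fin d))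
    (θ : EuclideanSpace ℝ (Fin d)) : Matrix (Fin d) (Fin d) ℝ :=
  Matrix.of fun i j => (fderiv ℝ g θ (EuclideanSpace.single j 1)) i

/-- `H(w, θ) = ∇_θ h(w, θ)`. -/
def stochGrad {𝓦 : Type*} {d : ℕ} (h : 𝓦 → EuclideanSpace ℝ (Fin d) → ℝ)
    (w : 𝓦) (θ : EuclideanSpace ℝ (Fin d)) : EuclideanSpace ℝ (Fin d) :=
  gradient (h w) θ

/-- The mean field `θ ↦ 𝔼_W[H(W, θ)]`, where `ν` is the law of `W`. -/
def meanGrad {𝓦 : Type*} [MeasurableSpace 𝓦] {d : ℕ} (ν : Measure 𝓦)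
    (h : 𝓦 → EuclideanSpace ℝ (Fin d) → ℝ) (θ : EuclideanSpace ℝ (Fin d)) :
    EuclideanSpace ℝ (Fin d) :=
  ∫ w, stochGrad h w θ ∂ν

/-- `Q` solves the Lyapunov equation `C Q + Q Cᵀ = S`. -/
def SolvesLyapunov {d : ℕ} (C S Q : Matrix (Fin d) (Fin d) ℝ) : Prop :=
  C * Q + Q * C.transpose = S

end

/-! The classical algorithm is the batch algorithm with `K = 1`, so both are chains `x ↦ x - μ F(s,
x)` driven by independent noise, with the same mean field `g`. Everything is proved for such a chain
under `AttractingField` and then transported to the trajectories.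

Average trajectories. Both are iterates of `x ↦ x - μ g(x)`. During `K` steps of size `μ'/K` the
point moves by `O(μ')‖g x‖`, so the accumulated drift differs from `g x` by a vector of norm
`O(μ')‖g x‖`, and a rank-one matrix `A` realizes that vector as `A (g x)`.

Existence of the limits (`exists_tendsto_iterate_transition`). The field is strongly monotone only
near `θs`, so two copies of the chain driven by the same noise approach each other in mean square
only there; far away only the distance to `θs` decreases. A semimetric of the form `(‖x - y‖²)^a (‖x
- θs‖² + ‖y - θs‖² + ε)^(1 - a)` with small `a` contracts in mean in both regimes. It dominates the
increments of quadratic forms, so second moments converge geometrically, with a limit independent of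
the start.

Size of the limits (`exists_stationary_secondMoment`). The one-step identity for second moments
about `θs` is `M_{n+1} = M_n - μ (C M_n + M_n Cᵀ) + μ² S` up to linearization errors, with `S` the
second moment of the noise at `θs`. A drift estimate gives `𝔼‖x - θs‖² = O(μ)`. The linearization
error is `o(‖x - θs‖²)` near `θs`, but far away it is only `O(‖x - θs‖²)`, so the far part must
contribute `o(μ)`. Fourth moments may be infinite; the test function `v²/(1 + v)` of `v = ‖x - θs‖²`
replaces them, and dominated convergence makes its mean `o(μ)`. Letting `n → ∞`, then `μ → 0`, gives
the Lyapunov equation, and coercivity of `C` makes its operator invertible.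

Conclusion. Averaging `K` independent samples, centred at `θs`, divides `S` and hence the solution
by `K`; the classical chain has the step divided by `K` instead. Both covariances are therefore
`(μ'/K)(Q + o(1))`. Recentring from `θs` to the average trajectory is harmless, since that
trajectory converges to `θs`. -/

noncomputable section

set_option linter.unusedSectionVars false

/-! ### Mean-square estimates for a random vector -/

section MeanSquare

variable {S E : Type*} [MeasurableSpace S] [NormedAddCommGroup E] [InnerProductSpace ℝ E]
  [CompleteSpace E] {ρ : Measure S}

lemma integrable_norm_sq_of_memLp {g : S → E} (hg : MemLp g 2 ρ) :
    Integrable (fun s => ‖g s‖ ^ 2) ρ :=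
  (memLp_two_iff_integrable_sq_norm hg.1).1 hg

/-- Jensen's inequality, obtained from the nonnegativity of the variance of `‖g‖`. -/
lemma norm_integral_sq_le [IsProbabilityMeasure ρ] {g : S → E} (hg : MemLp g 2 ρ) :
    ‖∫ s, g s ∂ρ‖ ^ 2 ≤ ∫ s, ‖g s‖ ^ 2 ∂ρ := by
  have h1 : Integrable g ρ := hg.integrable (by norm_num)
  set c := ∫ s, ‖g s‖ ∂ρ with hc
  have h0 : 0 ≤ ∫ s, (‖g s‖ - c) ^ 2 ∂ρ := integral_nonneg fun s => sq_nonneg _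
  have h2 : ∫ s, (‖g s‖ - c) ^ 2 ∂ρ = ∫ s, ‖g s‖ ^ 2 ∂ρ - c ^ 2 := by
    have : (fun s => (‖g s‖ - c) ^ 2) = fun s => ‖g s‖ ^ 2 - (2 * c) * ‖g s‖ + c ^ 2 := by
      ext s; ring
    have i1 : Integrable (fun s => ‖g s‖ ^ 2) ρ := integrable_norm_sq_of_memLp hg
    have i2 : Integrable (fun s => (2 * c) * ‖g s‖) ρ := h1.norm.const_mul _
    have i3 : Integrable (fun s => ‖g s‖ ^ 2 - (2 * c) * ‖g s‖) ρ := i1.sub i2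
    rw [this, integral_add i3 (integrable_const _), integral_sub i1 i2, integral_const_mul, ← hc]
    simp; ring
  have h3 : ‖∫ s, g s ∂ρ‖ ≤ c := norm_integral_le_integral_norm g
  have h4 := norm_nonneg (∫ s, g s ∂ρ)
  nlinarith

lemma integral_norm_sub_smul_sq [IsProbabilityMeasure ρ] {g : S → E} (hg : MemLp g 2 ρ)
    (u : E) (μ : ℝ) :
    ∫ s, ‖u - μ • g s‖ ^ 2 ∂ρ =
      ‖u‖ ^ 2 - 2 * μ * inner ℝ u (∫ s, g s ∂ρ) + μ ^ 2 * ∫ s, ‖g s‖ ^ 2 ∂ρ := by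
  have h1 : Integrable g ρ := hg.integrable (by norm_num)
  have : (fun s => ‖u - μ • g s‖ ^ 2) =
      fun s => ‖u‖ ^ 2 - 2 * μ * inner ℝ u (g s) + μ ^ 2 * ‖g s‖ ^ 2 := by
    ext s
    rw [norm_sub_sq_real, inner_smul_right, norm_smul, mul_pow, Real.norm_eq_abs, sq_abs]
    ring
  have h2 : Integrable (fun s => 2 * μ * inner ℝ u (g s)) ρ := (h1.const_inner u).const_mul _
  have h3 : Integrable (fun s => ‖u‖ ^ 2 - 2 * μ * inner ℝ u (g s)) ρ := (integrable_const _).sub h2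
  rw [this, integral_add h3
    ((integrable_norm_sq_of_memLp hg).const_mul _), integral_sub (integrable_const _) h2,
    integral_const_mul, integral_const_mul, integral_inner h1]
  simp

lemma memLp_sub_smul [IsProbabilityMeasure ρ] {g : S → E} (hg : MemLp g 2 ρ) (u : E) (μ : ℝ) :
    MemLp (fun s => u - μ • g s) 2 ρ :=
  (memLp_const u).sub (hg.const_smul μ)

end MeanSquare

/-! ### Attracting random fields and their one-step estimates -/

section Field

variable {S E : Type*} [MeasurableSpace S] [NormedAddCommGroup E] [InnerProductSpace ℝ E]
  [MeasurableSpace E]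

/-- A random vector field `F s`, `s ∼ ρ`, that is square integrable and mean-square Lipschitz, and
whose mean is `C¹` at the globally attracting point `θs`. -/
structure AttractingField (ρ : Measure S) (F : S → E → E) (θs : E) (L m : ℝ) : Prop where
  prob : IsProbabilityMeasure ρ
  meas : Measurable (Function.uncurry F)
  mom : ∀ x, MemLp (fun s => F s x) 2 ρ
  lip : ∀ x y, ∫ s, ‖F s x - F s y‖ ^ 2 ∂ρ ≤ L ^ 2 * ‖x - y‖ ^ 2
  smooth : ContDiffAt ℝ 1 (fun x => ∫ s, F s x ∂ρ) θs
  pos : 0 < m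
  -- Costs nothing, since `L` may be enlarged; it makes `L` positive and keeps `1 - m μ` nonnegative
  -- once `2 μ L² ≤ m`.
  le : m ≤ L
  attr : ∀ x, m * ‖x - θs‖ ^ 2 ≤ inner ℝ (∫ s, F s x ∂ρ) (x - θs)

/-- The mean of a random vector field. -/
def meanField (ρ : Measure S) (F : S → E → E) (x : E) : E := ∫ s, F s x ∂ρ

namespace AttractingField

variable [CompleteSpace E] {ρ : Measure S} {F : S → E → E} {θs : E} {L m : ℝ}

lemma L_pos (h : AttractingField ρ F θs L m) : 0 < L := h.pos.trans_le h.le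

lemma norm_meanField_sub_le (h : AttractingField ρ F θs L m) (x y : E) :
    ‖meanField ρ F x - meanField ρ F y‖ ≤ L * ‖x - y‖ := by
  have := h.prob
  have h1 := norm_integral_sq_le ((h.mom x).sub (h.mom y))
  simp only [Pi.sub_apply] at h1
  rw [integral_sub ((h.mom x).integrable (by norm_num)) ((h.mom y).integrable (by norm_num))] at h1
  have h2 := h1.trans (h.lip x y)
  rw [← mul_pow] at h2
  exact le_of_sq_le_sq h2 (by have := h.L_pos; positivity)

lemma attr' (h : AttractingField ρ F θs L m) (x : E) :
    m * ‖x - θs‖ ^ 2 ≤ inner ℝ (x - θs) (meanField ρ F x) := by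
  rw [real_inner_comm]; exact h.attr x

/-- Attraction at the points `θs - t g`, divided by `t`, gives `0 ≤ ⟪-g, g⟫` in the limit `t → 0⁺`.
-/
lemma meanField_eq_zero (h : AttractingField ρ F θs L m) : meanField ρ F θs = 0 := by
  set g := meanField ρ F θs with hg
  by_contra hne
  have hcont : Tendsto (fun t : ℝ => inner ℝ (-g) (meanField ρ F (θs + t • (-g)))) (𝓝[>] 0)
      (𝓝 (inner ℝ (-g) g)) := by
    have h1 : ContinuousAt (meanField ρ F) θs := h.smooth.continuousAt
    have h2 : ContinuousAt (fun t : ℝ => θs + t • (-g)) 0 := by fun_prop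
    have h3 : ContinuousAt (fun t : ℝ => meanField ρ F (θs + t • (-g))) 0 :=
      h1.comp_of_eq h2 (by simp)
    have h4 : ContinuousAt (fun t : ℝ => (inner ℝ (-g) (meanField ρ F (θs + t • (-g))) : ℝ)) 0 :=
      continuousAt_const.inner h3
    have h5 := h4.tendsto
    simp only [zero_smul, add_zero] at h5
    exact h5.mono_left nhdsWithin_le_nhds
  have h0 : (0 : ℝ) ≤ inner ℝ (-g) g := by
    refine ge_of_tendsto hcont ?_
    filter_upwards [self_mem_nhdsWithin] with t ht
    have ht : 0 < t := ht
    have h1 := h.attr' (θs + t • (-g))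
    rw [add_sub_cancel_left, inner_smul_left] at h1
    have h2 : 0 ≤ m * ‖t • (-g)‖ ^ 2 := by have := h.pos; positivity
    have h3 := h2.trans h1
    simp only [conj_trivial] at h3
    exact nonneg_of_mul_nonneg_right h3 ht
  rw [inner_neg_left, real_inner_self_eq_norm_sq] at h0
  have : 0 < ‖g‖ := norm_pos_iff.2 hne
  nlinarith

lemma norm_meanField_le (h : AttractingField ρ F θs L m) (x : E) :
    ‖meanField ρ F x‖ ≤ L * ‖x - θs‖ := by
  simpa [h.meanField_eq_zero] using h.norm_meanField_sub_le x θs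

/-- The linearization of the mean field. -/
lemma hasStrictFDerivAt (h : AttractingField ρ F θs L m) :
    HasStrictFDerivAt (meanField ρ F) (fderiv ℝ (meanField ρ F) θs) θs :=
  ContDiffAt.hasStrictFDerivAt h.smooth (by norm_num)

/-- Attraction at `θs + t u`, divided by `t²`, passes to the derivative as `t → 0⁺`. -/
lemma coercive (h : AttractingField ρ F θs L m) (u : E) :
    m * ‖u‖ ^ 2 ≤ inner ℝ u (fderiv ℝ (meanField ρ F) θs u) := by
  have hd := h.hasStrictFDerivAt.hasFDerivAt
  have hl : HasDerivAt (fun t : ℝ => meanField ρ F (θs + t • u)) (fderiv ℝ (meanField ρ F) θs u) 0 :=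
    by
    have h1 : HasDerivAt (fun t : ℝ => θs + t • u) u 0 := by
      simpa using ((hasDerivAt_id (0 : ℝ)).smul_const u).const_add θs
    have h2 : HasFDerivAt (meanField ρ F) (fderiv ℝ (meanField ρ F) θs) (θs + (0 : ℝ) • u) := by
      simpa using hd
    exact h2.comp_hasDerivAt (0 : ℝ) h1
  have hs := hl.tendsto_slope_zero_right
  have hs2 := (tendsto_const_nhds (x := u)).inner (𝕜 := ℝ) hs
  refine ge_of_tendsto hs2 ?_
  filter_upwards [self_mem_nhdsWithin] with t ht
  have ht : 0 < t := ht
  have h1 := h.attr' (θs + t • u)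
  simp only [zero_add, zero_smul, add_zero, h.meanField_eq_zero, sub_zero]
  rw [add_sub_cancel_left, inner_smul_left, norm_smul, Real.norm_of_nonneg ht.le] at h1
  simp only [conj_trivial] at h1
  rw [inner_smul_right]
  have h2 : m * ‖u‖ ^ 2 * t ^ 2 ≤ t * inner ℝ u (meanField ρ F (θs + t • u)) := by
    convert h1 using 1; ring
  rw [inv_mul_eq_div, le_div_iff₀ ht]
  nlinarith

/-- The variance of the field at the attracting point. -/
def _root_.noiseLevel (ρ : Measure S) (F : S → E → E) (θs : E) : ℝ := ∫ s, ‖F s θs‖ ^ 2 ∂ρ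

lemma _root_.noiseLevel_nonneg : 0 ≤ noiseLevel ρ F θs := integral_nonneg fun _ => sq_nonneg _

lemma integral_norm_sq_le (h : AttractingField ρ F θs L m) (x : E) :
    ∫ s, ‖F s x‖ ^ 2 ∂ρ ≤ 2 * noiseLevel ρ F θs + 2 * L ^ 2 * ‖x - θs‖ ^ 2 := by
  have h1 : ∫ s, ‖F s x‖ ^ 2 ∂ρ ≤ ∫ s, (2 * ‖F s θs‖ ^ 2 + 2 * ‖F s x - F s θs‖ ^ 2) ∂ρ := by
    refine integral_mono (integrable_norm_sq_of_memLp (h.mom x))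
      (((integrable_norm_sq_of_memLp (h.mom θs)).const_mul 2).add
      ((integrable_norm_sq_of_memLp ((h.mom x).sub (h.mom θs))).const_mul 2)) fun s => ?_
    have h2 : ‖F s x‖ ≤ ‖F s θs‖ + ‖F s x - F s θs‖ := by
      simpa using norm_add_le (F s θs) (F s x - F s θs)
    have := norm_nonneg (F s x)
    show ‖F s x‖ ^ 2 ≤ 2 * ‖F s θs‖ ^ 2 + 2 * ‖F s x - F s θs‖ ^ 2
    nlinarith [sq_nonneg (‖F s θs‖ - ‖F s x - F s θs‖)]
  have h3 : ∫ s, (2 * ‖F s θs‖ ^ 2 + 2 * ‖F s x - F s θs‖ ^ 2) ∂ρ =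
      2 * noiseLevel ρ F θs + 2 * ∫ s, ‖F s x - F s θs‖ ^ 2 ∂ρ := by
    have i1 : Integrable (fun s => 2 * ‖F s x - F s θs‖ ^ 2) ρ :=
      (integrable_norm_sq_of_memLp ((h.mom x).sub (h.mom θs))).const_mul 2
    rw [integral_add ((integrable_norm_sq_of_memLp (h.mom θs)).const_mul 2) i1, integral_const_mul, integral_const_mul, noiseLevel]
  have := h.lip x θs
  linarith

/-- One step of the recursion. -/
def _root_.fieldStep (F : S → E → E) (μ : ℝ) (x : E) (s : S) : E := x - μ • F s x

lemma integral_norm_step_sub_step_sq (h : AttractingField ρ F θs L m) (μ : ℝ) (x y : E) :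
    ∫ s, ‖fieldStep F μ x s - fieldStep F μ y s‖ ^ 2 ∂ρ ≤ ‖x - y‖ ^ 2 -
      2 * μ * inner ℝ (x - y) (meanField ρ F x - meanField ρ F y) +
        μ ^ 2 * (L ^ 2 * ‖x - y‖ ^ 2) := by
  have := h.prob
  have h1 := integral_norm_sub_smul_sq ((h.mom x).sub (h.mom y)) (x - y) μ
  simp only [Pi.sub_apply] at h1
  rw [integral_sub ((h.mom x).integrable (by norm_num)) ((h.mom y).integrable (by norm_num))] at h1
  have h2 : (fun s => ‖fieldStep F μ x s - fieldStep F μ y s‖ ^ 2) =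
      fun s => ‖x - y - μ • (F s x - F s y)‖ ^ 2 := by
    ext s; congr 2; simp only [fieldStep, smul_sub]; abel
  rw [h2, h1]
  have := mul_le_mul_of_nonneg_left (h.lip x y) (sq_nonneg μ)
  simp only [meanField]
  linarith

lemma memLp_step (h : AttractingField ρ F θs L m) (μ : ℝ) (x : E) :
    MemLp (fieldStep F μ x) 2 ρ :=
  have := h.prob
  memLp_sub_smul (h.mom x) x μ

lemma memLp_step_sub (h : AttractingField ρ F θs L m) (μ : ℝ) (x : E) :
    MemLp (fun s => fieldStep F μ x s - θs) 2 ρ :=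
  have := h.prob
  (h.memLp_step μ x).sub (memLp_const θs)

lemma integral_norm_step_sq (h : AttractingField ρ F θs L m) (μ : ℝ) (x : E) :
    ∫ s, ‖fieldStep F μ x s - θs‖ ^ 2 ∂ρ = ‖x - θs‖ ^ 2 -
      2 * μ * inner ℝ (x - θs) (meanField ρ F x) + μ ^ 2 * ∫ s, ‖F s x‖ ^ 2 ∂ρ := by
  have := h.prob
  rw [meanField, ← integral_norm_sub_smul_sq (h.mom x) (x - θs) μ]
  congr 1; ext s; congr 2; simp only [fieldStep]; abel

/-- The drift supplies `-2 m μ ‖x - θs‖²`; half of it absorbs the term `2 μ² L² ‖x - θs‖²` coming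
from the growth of the noise. -/
lemma integral_norm_step_sq_le (h : AttractingField ρ F θs L m) {μ : ℝ} (hμ : 0 ≤ μ)
    (hμL : 2 * μ * L ^ 2 ≤ m) (x : E) :
    ∫ s, ‖fieldStep F μ x s - θs‖ ^ 2 ∂ρ ≤
      (1 - m * μ) * ‖x - θs‖ ^ 2 + 2 * μ ^ 2 * noiseLevel ρ F θs := by
  rw [h.integral_norm_step_sq]
  have h1 := mul_le_mul_of_nonneg_left (h.integral_norm_sq_le x) (sq_nonneg μ)
  have h2 := mul_le_mul_of_nonneg_left (h.attr' x) hμ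
  have h3 : μ * (2 * μ * L ^ 2) * ‖x - θs‖ ^ 2 ≤ μ * m * ‖x - θs‖ ^ 2 := by gcongr
  nlinarith

end AttractingField

end Field

/-! ### The averaged recursion: many small steps against one large step -/

section MeanDynamics

variable {E : Type*} [NormedAddCommGroup E] [InnerProductSpace ℝ E]

/-- One step of the averaged recursion. -/
def meanStep (g : E → E) (μ : ℝ) (x : E) : E := x - μ • g x

/-- Discrete Grönwall: one step moves the point by `μ ‖g y‖`, hence changes `g` by at most `L μ ‖g
y‖`. -/
lemma norm_iterate_meanStep_le {g : E → E} {L : ℝ} (hL : 0 ≤ L)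
    (hg : ∀ x y, ‖g x - g y‖ ≤ L * ‖x - y‖) {μ : ℝ} (hμ : 0 ≤ μ) (x : E) (j : ℕ) :
    ‖g ((meanStep g μ)^[j] x)‖ ≤ (1 + L * μ) ^ j * ‖g x‖ := by
  induction j with
  | zero => simp
  | succ j ih =>
    rw [Function.iterate_succ_apply']
    set y := (meanStep g μ)^[j] x
    have h1 := hg (meanStep g μ y) y
    have h2 : meanStep g μ y - y = -(μ • g y) := by simp [meanStep]
    rw [h2, norm_neg, norm_smul, Real.norm_of_nonneg hμ] at h1
    have h3 : ‖g (meanStep g μ y)‖ ≤ ‖g (meanStep g μ y) - g y‖ + ‖g y‖ := by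
      simpa using norm_add_le (g (meanStep g μ y) - g y) (g y)
    have h4 : (1 + L * μ) * ‖g y‖ ≤ (1 + L * μ) * ((1 + L * μ) ^ j * ‖g x‖) := by gcongr
    calc _ ≤ (1 + L * μ) * ‖g y‖ := by linarith
      _ ≤ _ := by rw [pow_succ]; linarith

lemma norm_iterate_meanStep_sub_le {g : E → E} {L : ℝ} (hL : 0 ≤ L)
    (hg : ∀ x y, ‖g x - g y‖ ≤ L * ‖x - y‖) {μ : ℝ} (hμ : 0 ≤ μ) (x : E) (j : ℕ) :
    ‖(meanStep g μ)^[j] x - x‖ ≤ j * μ * ((1 + L * μ) ^ j * ‖g x‖) := by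
  induction j with
  | zero => simp
  | succ j ih =>
    have h1 := norm_iterate_meanStep_le hL hg hμ x j
    rw [Function.iterate_succ_apply']
    set y := (meanStep g μ)^[j] x
    have h2 : meanStep g μ y - x = (y - x) - μ • g y := by simp [meanStep]; abel
    have h3 : ‖(y - x) - μ • g y‖ ≤ ‖y - x‖ + μ * ‖g y‖ := by
      refine (norm_sub_le _ _).trans ?_
      rw [norm_smul, Real.norm_of_nonneg hμ]
    have h5 : (1 + L * μ) ^ j ≤ (1 + L * μ) ^ (j + 1) :=
      pow_le_pow_right₀ (by nlinarith [mul_nonneg hL hμ]) (Nat.le_succ j)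
    have h6 : ((j : ℝ) + 1) * μ * ((1 + L * μ) ^ j * ‖g x‖) ≤
      ((j : ℝ) + 1) * μ * ((1 + L * μ) ^ (j + 1) * ‖g x‖) := by gcongr
    have h7 := mul_le_mul_of_nonneg_left h1 hμ
    rw [h2]; push_cast
    linarith

lemma iterate_meanStep_eq_sub_sum (g : E → E) (μ : ℝ) (x : E) (j : ℕ) :
    (meanStep g μ)^[j] x = x - μ • ∑ i ∈ Finset.range j, g ((meanStep g μ)^[i] x) := by
  induction j with
  | zero => simp
  | succ j ih =>
    rw [Function.iterate_succ_apply', Finset.sum_range_succ, smul_add, meanStep]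
    nth_rewrite 1 [ih]
    abel

/-- The rank-one operator `z ↦ ‖x‖⁻² ⟪x, z⟫ e` has norm `‖e‖ / ‖x‖`. This turns an error bound
relative to `‖x‖` into a matrix perturbation. -/
lemma exists_continuousLinearMap_apply_eq (x e : E) {c : ℝ} (hc : 0 ≤ c) (he : ‖e‖ ≤ c * ‖x‖) :
    ∃ A : E →L[ℝ] E, ‖A‖ ≤ c ∧ A x = e := by
  by_cases hx : x = 0
  · subst hx
    refine ⟨0, by simpa using hc, ?_⟩
    have : ‖e‖ ≤ 0 := by simpa using he
    simpa using (norm_le_zero_iff.1 this).symm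
  · have hx' : 0 < ‖x‖ := norm_pos_iff.2 hx
    refine ⟨(innerSL ℝ x).smulRight ((‖x‖ ^ 2)⁻¹ • e), ?_, ?_⟩
    · rw [ContinuousLinearMap.norm_smulRight_apply, innerSL_apply_norm, norm_smul, norm_inv,
        norm_pow, norm_norm]
      calc ‖x‖ * ((‖x‖ ^ 2)⁻¹ * ‖e‖) ≤ ‖x‖ * ((‖x‖ ^ 2)⁻¹ * (c * ‖x‖)) := by gcongr
        _ = c := by field_simp
    · simp [smul_smul, hx'.ne']

/-- `K` small steps of the averaged recursion differ from one `K` times larger step by a relative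
perturbation of the order of the step. -/
lemma exists_iterate_meanStep_eq {g : E → E} {L : ℝ} (hL : 0 ≤ L)
    (hg : ∀ x y, ‖g x - g y‖ ≤ L * ‖x - y‖) {K : ℕ} (hK : 1 ≤ K) {μ : ℝ} (hμ : 0 < μ)
    (hμ1 : μ ≤ 1) (x : E) :
    ∃ A : E →L[ℝ] E, ‖A‖ ≤ L * Real.exp L * μ ∧
      (meanStep g (μ / K))^[K] x = x - μ • (1 + A) (g x) := by
  have hK0 : (0 : ℝ) < K := by exact_mod_cast hK
  set y : ℕ → E := fun j => (meanStep g (μ / K))^[j] x with hy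
  -- Mean deviation of the drift along the `K` small steps: the endpoint is `x - μ (g x + e)`.
  set e : E := (K : ℝ)⁻¹ • ∑ j ∈ Finset.range K, (g (y j) - g x) with he
  -- The compounded growth factor is bounded uniformly in `K`, by `μ ≤ 1`.
  have hexp : (1 + L * (μ / K)) ^ K ≤ Real.exp L := by
    calc (1 + L * (μ / K)) ^ K ≤ (Real.exp (L * (μ / K))) ^ K := by
          gcongr
          rw [add_comm]; exact Real.add_one_le_exp _
      _ = Real.exp (L * μ) := by rw [← Real.exp_nat_mul]; congr 1; field_simp
      _ ≤ Real.exp L := Real.exp_le_exp.2 (by nlinarith)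
  have hterm : ∀ j ∈ Finset.range K, ‖g (y j) - g x‖ ≤ L * Real.exp L * μ * ‖g x‖ := by
    intro j hj
    have hjK : j ≤ K := (Finset.mem_range.1 hj).le
    have h1 := norm_iterate_meanStep_sub_le hL hg (by positivity : 0 ≤ μ / K) x j
    have h2 : (1 + L * (μ / K)) ^ j ≤ Real.exp L :=
      (pow_le_pow_right₀ (by have : 0 ≤ L * (μ / K) := by positivity
                             linarith) hjK).trans hexp
    have h3 : (j : ℝ) * (μ / K) ≤ μ := by
      rw [mul_div_assoc', div_le_iff₀ hK0, mul_comm]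
      have : (j : ℝ) ≤ K := by exact_mod_cast hjK
      gcongr
    calc ‖g (y j) - g x‖ ≤ L * ‖y j - x‖ := hg _ _
      _ ≤ L * (j * (μ / K) * ((1 + L * (μ / K)) ^ j * ‖g x‖)) := by gcongr
      _ ≤ L * (μ * (Real.exp L * ‖g x‖)) := by gcongr
      _ = _ := by ring
  have hnorm : ‖e‖ ≤ L * Real.exp L * μ * ‖g x‖ := by
    rw [he, norm_smul, norm_inv, Real.norm_natCast]
    calc (K : ℝ)⁻¹ * ‖∑ j ∈ Finset.range K, (g (y j) - g x)‖
        ≤ (K : ℝ)⁻¹ * ∑ j ∈ Finset.range K, L * Real.exp L * μ * ‖g x‖ := by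
          gcongr; exact norm_sum_le_of_le _ hterm
      _ = _ := by rw [Finset.sum_const, Finset.card_range, nsmul_eq_mul]; field_simp
  obtain ⟨A, hA, hAx⟩ := exists_continuousLinearMap_apply_eq (g x) e
    (by positivity : 0 ≤ L * Real.exp L * μ) hnorm
  refine ⟨A, hA, ?_⟩
  rw [iterate_meanStep_eq_sub_sum, add_apply, hAx, he, Finset.sum_sub_distrib,
    Finset.sum_const, Finset.card_range, smul_sub, ← Nat.cast_smul_eq_nsmul ℝ, smul_smul,
    inv_mul_cancel₀ hK0.ne', one_smul, one_apply_eq_self, add_sub_cancel, smul_smul,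
    ← div_eq_mul_inv]

end MeanDynamics

/-! ### Convergence of the averaged recursion -/

section

variable {S E : Type*} [MeasurableSpace S] [NormedAddCommGroup E] [InnerProductSpace ℝ E]
  [MeasurableSpace E] [CompleteSpace E] {ρ : Measure S} {F : S → E → E} {θs : E} {L m : ℝ}

lemma AttractingField.tendsto_iterate_meanStep (h : AttractingField ρ F θs L m) {μ : ℝ}
    (hμ : 0 < μ) (hμL : 2 * μ * L ^ 2 ≤ m) (x : E) :
    Tendsto (fun t => (meanStep (meanField ρ F) μ)^[t] x) atTop (𝓝 θs) := by
  have hm := h.pos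
  have hL := h.L_pos
  have hmL := h.le
  have hstep : ∀ x, ‖meanStep (meanField ρ F) μ x - θs‖ ^ 2 ≤ (1 - m * μ) * ‖x - θs‖ ^ 2 := by
    intro x
    have h1 : meanStep (meanField ρ F) μ x - θs = (x - θs) - μ • meanField ρ F x := by
      simp only [meanStep]; abel
    rw [h1, norm_sub_sq_real, inner_smul_right, norm_smul, mul_pow, Real.norm_eq_abs, sq_abs]
    have h2 := mul_le_mul_of_nonneg_left (h.attr' x) hμ.le
    have h3 : ‖meanField ρ F x‖ ^ 2 ≤ (L * ‖x - θs‖) ^ 2 := by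
      gcongr; exact h.norm_meanField_le x
    have h4 := mul_le_mul_of_nonneg_left h3 (sq_nonneg μ)
    have h5 : μ * (2 * μ * L ^ 2) * ‖x - θs‖ ^ 2 ≤ μ * m * ‖x - θs‖ ^ 2 := by gcongr
    nlinarith [mul_nonneg (sq_nonneg μ) (sq_nonneg (L * ‖x - θs‖))]
  -- From `m ≤ L` and `2 μ L² ≤ m` one gets `2 m μ L ≤ 2 μ L² ≤ L`, so `m μ ≤ 1/2`.
  have hr0 : 0 ≤ 1 - m * μ := by
    have : 2 * (m * μ) * L ≤ 1 * L := by
      nlinarith [mul_le_mul_of_nonneg_left hmL (mul_nonneg hμ.le hL.le)]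
    have := le_of_mul_le_mul_right this hL
    linarith
  have hgeom : ∀ t, ‖(meanStep (meanField ρ F) μ)^[t] x - θs‖ ^ 2 ≤
      (1 - m * μ) ^ t * ‖x - θs‖ ^ 2 := by
    intro t
    induction t with
    | zero => simp
    | succ t ih =>
      rw [Function.iterate_succ_apply']
      refine (hstep _).trans ?_
      rw [pow_succ' (1 - m * μ), mul_assoc]
      gcongr
  rw [tendsto_iff_norm_sub_tendsto_zero]
  have hlim : Tendsto (fun t => (1 - m * μ) ^ t * ‖x - θs‖ ^ 2) atTop (𝓝 0) := by
    simpa using (tendsto_pow_atTop_nhds_zero_of_lt_one hr0 (by nlinarith)).mul_const (‖x - θs‖ ^ 2)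
  have hsq := squeeze_zero (fun t => sq_nonneg _) hgeom hlim
  have := hsq.sqrt
  simpa [Real.sqrt_sq] using this

end

/-! ### Transition operator and laws of the chain -/

section Law

variable {S E : Type*} [MeasurableSpace S] [NormedAddCommGroup E] [InnerProductSpace ℝ E]
  [FiniteDimensional ℝ E] [MeasurableSpace E] [BorelSpace E]

/-- The transition operator of the Markov chain `x ↦ x - μ F(s, x)`, `s ∼ ρ`. -/
def transition (ρ : Measure S) (F : S → E → E) (μ : ℝ) (f : E → ℝ) (x : E) : ℝ :=
  ∫ s, f (fieldStep F μ x s) ∂ρ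

/-- The law at time `n` of the Markov chain `x ↦ x - μ F(s, x)`, `s ∼ ρ`, started at `x`. -/
def chainLaw (ρ : Measure S) (F : S → E → E) (μ : ℝ) (x : E) : ℕ → Measure E
  | 0 => Measure.dirac x
  | n + 1 => ((chainLaw ρ F μ x n).prod ρ).map (fun p => fieldStep F μ p.1 p.2)

/-- Measurable functions of at most quadratic growth. -/
def QuadGrowth (θs : E) (f : E → ℝ) : Prop :=
  Measurable f ∧ ∃ c, ∀ x, |f x| ≤ c * (1 + ‖x - θs‖ ^ 2)

namespace QuadGrowth

variable {θs : E} {f g : E → ℝ}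

lemma exists_nonneg (hf : QuadGrowth θs f) : ∃ c, 0 ≤ c ∧ ∀ x, |f x| ≤ c * (1 + ‖x - θs‖ ^ 2) := by
  obtain ⟨-, c, hc⟩ := hf
  refine ⟨c, ?_, hc⟩
  have := (abs_nonneg _).trans (hc θs)
  simpa using this

lemma add (hf : QuadGrowth θs f) (hg : QuadGrowth θs g) : QuadGrowth θs (fun x => f x + g x) := by
  obtain ⟨hfm, c, hc⟩ := hf
  obtain ⟨hgm, c', hc'⟩ := hg
  refine ⟨hfm.add hgm, c + c', fun x => (abs_add_le _ _).trans ?_⟩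
  linarith [hc x, hc' x]

lemma const_mul (hf : QuadGrowth θs f) (a : ℝ) : QuadGrowth θs (fun x => a * f x) := by
  obtain ⟨hfm, c, hc⟩ := hf
  refine ⟨hfm.const_mul a, |a| * c, fun x => ?_⟩
  rw [abs_mul, mul_assoc]
  exact mul_le_mul_of_nonneg_left (hc x) (abs_nonneg a)

lemma const (θs : E) (a : ℝ) : QuadGrowth θs (fun _ => a) :=
  ⟨measurable_const, |a|, fun x =>
    le_mul_of_one_le_right (abs_nonneg a) (le_add_of_nonneg_right (by positivity))⟩

lemma sq (θs : E) : QuadGrowth θs (fun x => ‖x - θs‖ ^ 2) :=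
  ⟨by fun_prop, 1, fun x => by rw [abs_of_nonneg (by positivity)]; linarith⟩

lemma of_le (hf : Measurable f) (hg : QuadGrowth θs g) (hfg : ∀ x, |f x| ≤ g x) :
    QuadGrowth θs f := by
  obtain ⟨-, c, hc⟩ := hg
  exact ⟨hf, c, fun x => (hfg x).trans ((le_abs_self _).trans (hc x))⟩

end QuadGrowth

variable {ρ : Measure S} {F : S → E → E} {θs : E} {L m : ℝ}

namespace AttractingField

lemma measurable_step (h : AttractingField ρ F θs L m) (μ : ℝ) :
    Measurable (fun p : E × S => fieldStep F μ p.1 p.2) := by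
  have : Measurable (fun p : E × S => F p.2 p.1) := h.meas.comp measurable_swap
  exact measurable_fst.sub (this.const_smul μ)

lemma integrable_comp_step (h : AttractingField ρ F θs L m) (μ : ℝ) {f : E → ℝ}
    (hf : QuadGrowth θs f) (x : E) : Integrable (fun s => f (fieldStep F μ x s)) ρ := by
  have := h.prob
  obtain ⟨c, hc⟩ := hf.2
  have hb : Integrable (fun s => c * (1 + ‖fieldStep F μ x s - θs‖ ^ 2)) ρ :=
    ((integrable_const _).add (integrable_norm_sq_of_memLp (h.memLp_step_sub μ x))).const_mul c
  refine hb.mono' ?_ (ae_of_all _ fun s => hc _)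
  exact (hf.1.comp ((h.measurable_step μ).comp (measurable_prodMk_left))).aestronglyMeasurable

lemma exists_integral_norm_step_sq_le (h : AttractingField ρ F θs L m) (μ : ℝ) :
    ∃ c, 0 ≤ c ∧ ∀ x, ∫ s, ‖fieldStep F μ x s - θs‖ ^ 2 ∂ρ ≤ c * (1 + ‖x - θs‖ ^ 2) := by
  have hN : 0 ≤ noiseLevel ρ F θs := noiseLevel_nonneg
  have hL := h.L_pos
  refine ⟨1 + 2 * |μ| * L + μ ^ 2 * (2 * noiseLevel ρ F θs + 2 * L ^ 2), by positivity,
    fun x => ?_⟩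
  rw [h.integral_norm_step_sq]
  have h1 := mul_le_mul_of_nonneg_left (h.integral_norm_sq_le x) (sq_nonneg μ)
  have h2 : -(2 * μ * inner ℝ (x - θs) (meanField ρ F x)) ≤ 2 * |μ| * L * ‖x - θs‖ ^ 2 := by
    refine (neg_le_abs _).trans ?_
    rw [abs_mul, abs_mul, abs_two]
    have : |inner ℝ (x - θs) (meanField ρ F x)| ≤ ‖x - θs‖ * (L * ‖x - θs‖) :=
      (abs_real_inner_le_norm _ _).trans (by gcongr; exact h.norm_meanField_le x)
    calc _ ≤ 2 * |μ| * (‖x - θs‖ * (L * ‖x - θs‖)) := by gcongr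
      _ = _ := by ring
  have h3 : 0 ≤ 2 * |μ| * L := by positivity
  have h4 : 0 ≤ μ ^ 2 * (2 * noiseLevel ρ F θs) * ‖x - θs‖ ^ 2 := by positivity
  have h5 : 0 ≤ μ ^ 2 * (2 * L ^ 2) := by positivity
  nlinarith

lemma measurable_transition (h : AttractingField ρ F θs L m) (μ : ℝ) {f : E → ℝ}
    (hf : Measurable f) : Measurable (transition ρ F μ f) := by
  have := h.prob
  have h1 : StronglyMeasurable (Function.uncurry fun x s => f (fieldStep F μ x s)) :=
    (hf.comp (h.measurable_step μ)).stronglyMeasurable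
  exact h1.integral_prod_right.measurable

lemma quadGrowth_transition (h : AttractingField ρ F θs L m) (μ : ℝ) {f : E → ℝ}
    (hf : QuadGrowth θs f) : QuadGrowth θs (transition ρ F μ f) := by
  have := h.prob
  obtain ⟨c, hc0, hc⟩ := hf.exists_nonneg
  obtain ⟨c', hc'0, hc'⟩ := h.exists_integral_norm_step_sq_le μ
  refine ⟨h.measurable_transition μ hf.1, c * (1 + c'), fun x => ?_⟩
  have i1 := integrable_norm_sq_of_memLp (h.memLp_step_sub μ x)
  calc |transition ρ F μ f x| ≤ ∫ s, |f (fieldStep F μ x s)| ∂ρ := abs_integral_le_integral_abs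
    _ ≤ ∫ s, c * (1 + ‖fieldStep F μ x s - θs‖ ^ 2) ∂ρ :=
        integral_mono (h.integrable_comp_step μ hf x).abs
          (((integrable_const _).add i1).const_mul c) fun s => hc _
    _ = c * (1 + ∫ s, ‖fieldStep F μ x s - θs‖ ^ 2 ∂ρ) := by
        rw [integral_const_mul, integral_add (integrable_const _) i1]; simp
    _ ≤ c * (1 + c' * (1 + ‖x - θs‖ ^ 2)) := by gcongr; exact hc' x
    _ ≤ c * ((1 + c') * (1 + ‖x - θs‖ ^ 2)) := by
        gcongr; nlinarith [sq_nonneg ‖x - θs‖]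
    _ = _ := by ring

lemma isProbabilityMeasure_chainLaw (h : AttractingField ρ F θs L m) (μ : ℝ) (x : E) (n : ℕ) :
    IsProbabilityMeasure (chainLaw ρ F μ x n) := by
  have := h.prob
  induction n with
  | zero => exact inferInstanceAs (IsProbabilityMeasure (Measure.dirac x))
  | succ n ih => exact Measure.isProbabilityMeasure_map (h.measurable_step μ).aemeasurable

/-- Only the squared distance has to be treated; it propagates from one law to the next by Fubini
and the one-step quadratic bound. -/
lemma integrable_chainLaw (h : AttractingField ρ F θs L m) (μ : ℝ) (x : E) (n : ℕ) {f : E → ℝ}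
    (hf : QuadGrowth θs f) : Integrable f (chainLaw ρ F μ x n) := by
  have := h.prob
  have hp := h.isProbabilityMeasure_chainLaw μ x
  suffices hsq : Integrable (fun y => ‖y - θs‖ ^ 2) (chainLaw ρ F μ x n) by
    obtain ⟨c, hc⟩ := hf.2
    have := hp n
    exact (((integrable_const 1).add hsq).const_mul c).mono' hf.1.aestronglyMeasurable
      (ae_of_all _ hc)
  induction n with
  | zero => exact integrable_dirac (by simp)
  | succ n ih =>
    have := hp n
    obtain ⟨c', hc'0, hc'⟩ := h.exists_integral_norm_step_sq_le μ
    rw [chainLaw, integrable_map_measure (by fun_prop) (h.measurable_step μ).aemeasurable]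
    have hm : Measurable (fun p : E × S => ‖fieldStep F μ p.1 p.2 - θs‖ ^ 2) := by
      have := h.measurable_step μ
      fun_prop
    refine (integrable_prod_iff hm.aestronglyMeasurable).2 ⟨ae_of_all _ fun y => ?_, ?_⟩
    · exact integrable_norm_sq_of_memLp (h.memLp_step_sub μ y)
    · refine (((integrable_const 1).add ih).const_mul c').mono'
        hm.stronglyMeasurable.norm.integral_prod_right'.aestronglyMeasurable
        (ae_of_all _ fun y => ?_)
      rw [Real.norm_of_nonneg (integral_nonneg fun _ => norm_nonneg _)]
      simpa using hc' y

lemma integral_chainLaw_succ (h : AttractingField ρ F θs L m) (μ : ℝ) (x : E) (n : ℕ) {f : E → ℝ}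
    (hf : QuadGrowth θs f) :
    ∫ y, f y ∂(chainLaw ρ F μ x (n + 1)) = ∫ y, transition ρ F μ f y ∂(chainLaw ρ F μ x n) := by
  have := h.prob
  have := h.isProbabilityMeasure_chainLaw μ x n
  have hi := h.integrable_chainLaw μ x (n + 1) hf
  rw [chainLaw, integrable_map_measure hf.1.aestronglyMeasurable
    (h.measurable_step μ).aemeasurable] at hi
  rw [chainLaw, integral_map (h.measurable_step μ).aemeasurable hf.1.aestronglyMeasurable]
  exact integral_prod _ hi

lemma integral_chainLaw (h : AttractingField ρ F θs L m) (μ : ℝ) (x : E) (n : ℕ) {f : E → ℝ}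
    (hf : QuadGrowth θs f) :
    ∫ y, f y ∂(chainLaw ρ F μ x n) = (transition ρ F μ)^[n] f x := by
  induction n generalizing f with
  | zero => simp [chainLaw, integral_dirac]
  | succ n ih =>
    rw [h.integral_chainLaw_succ μ x n hf, ih (h.quadGrowth_transition μ hf),
      Function.iterate_succ_apply]

end AttractingField

end Law

/-! ### Ergodicity through a contracting semimetric -/

section Contraction

/-- Weighted AM-GM for the ratios `A/A₀` and `B/B₀`. The right side is linear in `A` and `B`, so it
can be integrated knowing only their means. -/
lemma rpow_mul_rpow_le {a A B A₀ B₀ : ℝ} (ha : 0 ≤ a) (ha1 : a ≤ 1) (hA : 0 ≤ A) (hB : 0 ≤ B)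
    (hA₀ : 0 < A₀) (hB₀ : 0 < B₀) :
    A ^ a * B ^ (1 - a) ≤ A₀ ^ a * B₀ ^ (1 - a) * (a * (A / A₀) + (1 - a) * (B / B₀)) := by
  have h := Real.geom_mean_le_arith_mean2_weighted ha (sub_nonneg.2 ha1)
    (div_nonneg hA hA₀.le) (div_nonneg hB hB₀.le) (by ring)
  rw [Real.div_rpow hA hA₀.le, Real.div_rpow hB hB₀.le] at h
  have h1 : 0 < A₀ ^ a := Real.rpow_pos_of_pos hA₀ _
  have h2 : 0 < B₀ ^ (1 - a) := Real.rpow_pos_of_pos hB₀ _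
  calc A ^ a * B ^ (1 - a) =
      A₀ ^ a * B₀ ^ (1 - a) * (A ^ a / A₀ ^ a * (B ^ (1 - a) / B₀ ^ (1 - a))) := by field_simp
    _ ≤ _ := by gcongr

variable {S E : Type*} [MeasurableSpace S] [NormedAddCommGroup E] [InnerProductSpace ℝ E]
  [FiniteDimensional ℝ E] [MeasurableSpace E] [BorelSpace E]

/-- A semimetric which interpolates between the squared distance and the distance to `θs`. -/
def interpDist (θs : E) (a ε : ℝ) (x y : E) : ℝ :=
  (‖x - y‖ ^ 2) ^ a * (‖x - θs‖ ^ 2 + ‖y - θs‖ ^ 2 + ε) ^ (1 - a)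

lemma interpDist_nonneg (θs : E) {a ε : ℝ} (hε : 0 ≤ ε) (x y : E) :
    0 ≤ interpDist θs a ε x y := by
  unfold interpDist; positivity

/-- Write `D = (D²)^a (D²)^(1/2 - a)`; the second factor and the sum of distances are at most powers
of `2B` with exponents adding up to `1 - a`. The condition `a ≤ 1/2` keeps the exponent `1/2 - a`
nonnegative. Quadratic forms are thus Lipschitz for the semimetric. -/
lemma norm_sub_mul_le_interpDist (θs : E) {a ε : ℝ} (ha : 0 ≤ a) (ha2 : a ≤ 1 / 2) (hε : 0 < ε)
    (x y : E) :
    ‖x - y‖ * (‖x - θs‖ + ‖y - θs‖) ≤ 2 * interpDist θs a ε x y := by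
  set D := ‖x - y‖ with hD
  set B := ‖x - θs‖ ^ 2 + ‖y - θs‖ ^ 2 + ε with hB
  have hD0 : 0 ≤ D := norm_nonneg _
  have hB0 : 0 < B := by positivity
  have htri : D ≤ ‖x - θs‖ + ‖y - θs‖ := by
    have : x - y = (x - θs) - (y - θs) := by abel
    rw [hD, this]; exact norm_sub_le _ _
  have hsum : (‖x - θs‖ + ‖y - θs‖) ^ 2 ≤ 2 * B := by
    nlinarith [sq_nonneg (‖x - θs‖ - ‖y - θs‖)]
  have hD2 : D ^ 2 ≤ 2 * B := le_trans (by gcongr) hsum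
  have e1 : D = (D ^ 2) ^ a * (D ^ 2) ^ (1 / 2 - a) := by
    rw [← Real.rpow_add_of_nonneg (sq_nonneg D) ha (by linarith), add_sub_cancel,
      ← Real.sqrt_eq_rpow, Real.sqrt_sq hD0]
  have e2 : ‖x - θs‖ + ‖y - θs‖ ≤ (2 * B) ^ (1 / 2 : ℝ) := by
    rw [← Real.sqrt_eq_rpow]
    exact Real.le_sqrt_of_sq_le hsum
  have e3 : (D ^ 2) ^ (1 / 2 - a) ≤ (2 * B) ^ (1 / 2 - a) := by
    gcongr
  have e4 : (2 * B) ^ (1 - a) ≤ 2 * B ^ (1 - a) := by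
    rw [Real.mul_rpow (by norm_num) hB0.le]
    gcongr
    calc (2 : ℝ) ^ (1 - a) ≤ 2 ^ (1 : ℝ) := Real.rpow_le_rpow_of_exponent_le (by norm_num)
          (by linarith)
      _ = 2 := by norm_num
  calc D * (‖x - θs‖ + ‖y - θs‖)
      = (D ^ 2) ^ a * (D ^ 2) ^ (1 / 2 - a) * (‖x - θs‖ + ‖y - θs‖) := by rw [← e1]
    _ ≤ (D ^ 2) ^ a * (2 * B) ^ (1 / 2 - a) * (2 * B) ^ (1 / 2 : ℝ) := by gcongr
    _ = (D ^ 2) ^ a * (2 * B) ^ (1 - a) := by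
        rw [mul_assoc, ← Real.rpow_add (by positivity)]; congr 2; ring
    _ ≤ (D ^ 2) ^ a * (2 * B ^ (1 - a)) := by gcongr
    _ = 2 * interpDist θs a ε x y := by rw [interpDist]; ring

variable {ρ : Measure S} {F : S → E → E} {θs : E} {L m : ℝ}

namespace AttractingField

/-- Being `C¹` at `θs` gives strict differentiability, which controls increments between two
arbitrary nearby points; an error `m/2` leaves half of the coercivity. -/
lemma exists_strongly_monotone (h : AttractingField ρ F θs L m) :
    ∃ r > 0, ∀ x y, ‖x - θs‖ ≤ r → ‖y - θs‖ ≤ r →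
      m / 2 * ‖x - y‖ ^ 2 ≤ inner ℝ (x - y) (meanField ρ F x - meanField ρ F y) := by
  have hm := h.pos
  have h1 := h.hasStrictFDerivAt.isLittleO.def (by positivity : 0 < m / 2)
  rw [Metric.eventually_nhds_iff] at h1
  obtain ⟨r, hr, hball⟩ := h1
  refine ⟨r / 2, by positivity, fun x y hx hy => ?_⟩
  have h2 := hball (y := (x, y)) (by
    rw [Prod.dist_eq, dist_eq_norm, dist_eq_norm]
    exact max_lt (by simpa using (by linarith : ‖x - θs‖ < r))
      (by simpa using (by linarith : ‖y - θs‖ < r)))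
  simp only at h2
  have h3 := h.coercive (x - y)
  have h4 : |inner ℝ (x - y) (meanField ρ F x - meanField ρ F y -
      fderiv ℝ (meanField ρ F) θs (x - y))| ≤ ‖x - y‖ * (m / 2 * ‖x - y‖) :=
    (abs_real_inner_le_norm _ _).trans (by gcongr)
  rw [inner_sub_right] at h4
  have := (abs_le.1 h4).1
  nlinarith

/-- The mean one-step change of the two ingredients of `interpDist`. -/
lemma exists_mean_contraction (h : AttractingField ρ F θs L m) :
    ∃ a ε : ℝ, 0 < a ∧ a ≤ 1 / 2 ∧ 0 < ε ∧ ∀ᶠ μ in 𝓝[>] (0 : ℝ), ∃ κ : ℝ, 0 ≤ κ ∧ κ < 1 ∧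
      ∀ x y : E, x ≠ y →
        a * ((∫ s, ‖fieldStep F μ x s - fieldStep F μ y s‖ ^ 2 ∂ρ) / ‖x - y‖ ^ 2) +
          (1 - a) * ((∫ s, ‖fieldStep F μ x s - θs‖ ^ 2 ∂ρ +
            ∫ s, ‖fieldStep F μ y s - θs‖ ^ 2 ∂ρ + ε) / (‖x - θs‖ ^ 2 + ‖y - θs‖ ^ 2 + ε)) ≤ κ := by
  have hm := h.pos
  have hL := h.L_pos
  have hmL := h.le
  have hN : 0 ≤ noiseLevel ρ F θs := noiseLevel_nonneg
  obtain ⟨r, hr, hmono⟩ := h.exists_strongly_monotone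
  -- Away from `θs` the squared mutual distance may expand at rate `3 L μ`. The weight makes `3 a L
  -- = (1 - a) m / 4`, half of the gain `(1 - a) m / 2` of the other factor.
  set a := m / (12 * L + m) with ha
  -- If one point lies outside the ball of radius `r`, then `W ≥ r² = 2 ε`, so the decay of `W` also
  -- pays for the constant `ε`.
  set ε := r ^ 2 / 2 with hεdef
  have hε : 0 < ε := by positivity
  have ha0 : 0 < a := by positivity
  have ha2 : a ≤ 1 / 2 := by rw [ha, div_le_div_iff₀ (by positivity) (by norm_num)]; linarith
  have haL : a * (12 * L + m) = m := by rw [ha]; field_simp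
  refine ⟨a, ε, ha0, ha2, hε, ?_⟩
  have small : ∀ c b : ℝ, 0 < b → ∀ᶠ μ in 𝓝[>] (0 : ℝ), c * μ < b := by
    intro c b hb
    have : Tendsto (fun μ : ℝ => c * μ) (𝓝[>] 0) (𝓝 (c * 0)) :=
      (Continuous.tendsto (by fun_prop) 0).mono_left nhdsWithin_le_nhds
    exact this.eventually_lt_const (by simpa using hb)
  filter_upwards [self_mem_nhdsWithin, small (2 * L ^ 2) m hm, small L 1 one_pos,
    small (16 * noiseLevel ρ F θs) (a * m * ε) (by positivity), small m 1 one_pos] with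
    μ hμ hμ1 hμ2 hμ3 hμ4
  have hμ : 0 < μ := hμ
  have hamμ : a * (m * μ) ≤ 1 / 2 * 1 := by gcongr
  refine ⟨1 - a * m * μ / 4, by linarith, by have : 0 < a * m * μ := by positivity
                                             linarith, fun x y hxy => ?_⟩
  have hD : 0 < ‖x - y‖ ^ 2 := by have := norm_pos_iff.2 (sub_ne_zero.2 hxy); positivity
  set W := ‖x - θs‖ ^ 2 + ‖y - θs‖ ^ 2 with hW
  have hW0 : 0 ≤ W := by positivity
  have hB : 0 < W + ε := by positivity
  have hA := h.integral_norm_step_sub_step_sq μ x y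
  have hVx := h.integral_norm_step_sq_le hμ.le (by linarith) x
  have hVy := h.integral_norm_step_sq_le hμ.le (by linarith) y
  set IA := ∫ s, ‖fieldStep F μ x s - fieldStep F μ y s‖ ^ 2 ∂ρ
  set Ix := ∫ s, ‖fieldStep F μ x s - θs‖ ^ 2 ∂ρ
  set Iy := ∫ s, ‖fieldStep F μ y s - θs‖ ^ 2 ∂ρ
  have h1a : 0 ≤ 1 - a := by linarith
  have hVsum : Ix + Iy + ε ≤ (1 - m * μ) * W + 4 * μ ^ 2 * noiseLevel ρ F θs + ε := by
    rw [hW]; linarith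
  have hmain : ∀ p q, IA ≤ p * ‖x - y‖ ^ 2 → Ix + Iy + ε ≤ q * (W + ε) →
      a * p + (1 - a) * q ≤ 1 - a * m * μ / 4 →
      a * (IA / ‖x - y‖ ^ 2) + (1 - a) * ((Ix + Iy + ε) / (W + ε)) ≤ 1 - a * m * μ / 4 := by
    intro p q hp hq hpq
    refine le_trans ?_ hpq
    gcongr
    · exact (div_le_iff₀ hD).2 hp
    · exact (div_le_iff₀ hB).2 hq
  have hμ2L : μ ^ 2 * (L ^ 2 * ‖x - y‖ ^ 2) ≤ μ * m / 2 * ‖x - y‖ ^ 2 := by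
    have : μ * (2 * L ^ 2 * μ) * ‖x - y‖ ^ 2 ≤ μ * m * ‖x - y‖ ^ 2 := by gcongr
    linarith
  by_cases hin : ‖x - θs‖ ≤ r ∧ ‖y - θs‖ ≤ r
  -- Both points near `θs`: the mutual distance contracts, and the noise inflates the other factor
  -- only slightly, because `16 N μ < a m ε` with `N` the noise level.
  · refine hmain (1 - m * μ / 2) (1 + a * m * μ / 4) ?_ ?_ ?_
    · have := mul_le_mul_of_nonneg_left (hmono x y hin.1 hin.2) hμ.le
      linarith
    · have h1 : 4 * μ ^ 2 * noiseLevel ρ F θs ≤ a * m * μ / 4 * ε := by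
        have := mul_le_mul_of_nonneg_left hμ3.le hμ.le
        linarith
      have h2 : 0 ≤ a * m * μ / 4 * W := by positivity
      have h3 : 0 ≤ m * μ * W := by positivity
      linarith
    · have : 0 ≤ a * (a * m * μ) := by positivity
      linarith
  -- One point far away: the mutual distance may expand, with `2 L μ` from the drift and `(L μ)² ≤ L
  -- μ` from the noise, but the distances to `θs` contract.
  · refine hmain (1 + 3 * (L * μ)) (1 - m * μ / 2) ?_ ?_ ?_
    · have h1 : -inner ℝ (x - y) (meanField ρ F x - meanField ρ F y) ≤ L * ‖x - y‖ ^ 2 := by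
        refine (neg_le_abs _).trans ((abs_real_inner_le_norm _ _).trans ?_)
        have := mul_le_mul_of_nonneg_left (h.norm_meanField_sub_le x y) (norm_nonneg (x - y))
        linarith
      have h2 := mul_le_mul_of_nonneg_left h1 hμ.le
      have h3 : L * μ * (L * μ) * ‖x - y‖ ^ 2 ≤ 1 * (L * μ) * ‖x - y‖ ^ 2 := by gcongr
      linarith
    · have hWr : r ^ 2 ≤ W := by
        rw [not_and_or, not_le, not_le] at hin
        rcases hin with hin | hin
        · have : r ^ 2 ≤ ‖x - θs‖ ^ 2 := by gcongr
          have := sq_nonneg ‖y - θs‖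
          linarith
        · have : r ^ 2 ≤ ‖y - θs‖ ^ 2 := by gcongr
          have := sq_nonneg ‖x - θs‖
          linarith
      have h1 : a * m * ε ≤ 1 * m * ε := by gcongr; linarith
      have h2 : μ * (8 * noiseLevel ρ F θs * μ + m * ε) ≤ μ * (m * W) := by
        gcongr
        have : m * (2 * ε) ≤ m * W := by gcongr; rw [hεdef]; linarith
        linarith [mul_nonneg hN hμ.le]
      linarith
    · have h1 : a * m ≤ a * L := by gcongr
      have h2 : μ * (a * (12 * L + m)) = μ * m := by rw [haL]
      have h3 : μ * (a * m) ≤ μ * (a * L) := by gcongr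
      have h4 : 0 ≤ μ * (a * L) := by positivity
      linarith

/-- Synchronous coupling: both points are moved by the same `s`. AM-GM with reference values at `(x,
y)` bounds the mean semimetric after the step by the old one times the averaged ratios. -/
lemma exists_interpDist_contraction (h : AttractingField ρ F θs L m) :
    ∃ a ε : ℝ, 0 < a ∧ a ≤ 1 / 2 ∧ 0 < ε ∧ ∀ᶠ μ in 𝓝[>] (0 : ℝ), ∃ κ : ℝ, 0 ≤ κ ∧ κ < 1 ∧
      ∀ (f : E → ℝ) (C : ℝ), 0 ≤ C → QuadGrowth θs f →
        (∀ x y, |f x - f y| ≤ C * interpDist θs a ε x y) →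
        ∀ x y, |transition ρ F μ f x - transition ρ F μ f y| ≤
          C * κ * interpDist θs a ε x y := by
  obtain ⟨a, ε, ha, ha2, hε, hev⟩ := h.exists_mean_contraction
  refine ⟨a, ε, ha, ha2, hε, hev.mono fun μ ⟨κ, hκ0, hκ1, hκ⟩ => ⟨κ, hκ0, hκ1, ?_⟩⟩
  intro f C hC hf hfΦ x y
  have hprob := h.prob
  by_cases hxy : x = y
  · subst hxy
    rw [sub_self, abs_zero]
    have := interpDist_nonneg θs (a := a) hε.le x x
    positivity
  have hA₀ : 0 < ‖x - y‖ ^ 2 := by have := norm_pos_iff.2 (sub_ne_zero.2 hxy); positivity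
  have hB₀ : 0 < ‖x - θs‖ ^ 2 + ‖y - θs‖ ^ 2 + ε := by positivity
  set x' := fieldStep F μ x
  set y' := fieldStep F μ y
  have iA : Integrable (fun s => ‖x' s - y' s‖ ^ 2) ρ :=
    integrable_norm_sq_of_memLp ((h.memLp_step μ x).sub (h.memLp_step μ y))
  have ix : Integrable (fun s => ‖x' s - θs‖ ^ 2) ρ :=
    integrable_norm_sq_of_memLp (h.memLp_step_sub μ x)
  have iy : Integrable (fun s => ‖y' s - θs‖ ^ 2) ρ :=
    integrable_norm_sq_of_memLp (h.memLp_step_sub μ y)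
  have ixy : Integrable (fun s => ‖x' s - θs‖ ^ 2 + ‖y' s - θs‖ ^ 2) ρ := ix.add iy
  have iB : Integrable (fun s => ‖x' s - θs‖ ^ 2 + ‖y' s - θs‖ ^ 2 + ε) ρ :=
    ixy.add (integrable_const _)
  have i1 : Integrable (fun s => a * (‖x' s - y' s‖ ^ 2 / ‖x - y‖ ^ 2)) ρ :=
    (iA.div_const _).const_mul _
  have i2 : Integrable (fun s => (1 - a) * ((‖x' s - θs‖ ^ 2 + ‖y' s - θs‖ ^ 2 + ε) /
      (‖x - θs‖ ^ 2 + ‖y - θs‖ ^ 2 + ε))) ρ := (iB.div_const _).const_mul _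
  have hfx := h.integrable_comp_step μ hf x
  have hfy := h.integrable_comp_step μ hf y
  calc |transition ρ F μ f x - transition ρ F μ f y|
      = |∫ s, (f (x' s) - f (y' s)) ∂ρ| := by rw [transition, transition, integral_sub hfx hfy]
    _ ≤ ∫ s, |f (x' s) - f (y' s)| ∂ρ := abs_integral_le_integral_abs
    _ ≤ ∫ s, C * (interpDist θs a ε x y * (a * (‖x' s - y' s‖ ^ 2 / ‖x - y‖ ^ 2) +
          (1 - a) * ((‖x' s - θs‖ ^ 2 + ‖y' s - θs‖ ^ 2 + ε) /
            (‖x - θs‖ ^ 2 + ‖y - θs‖ ^ 2 + ε)))) ∂ρ := by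
        refine integral_mono (hfx.sub hfy).abs (((i1.add i2).const_mul _).const_mul C) fun s => ?_
        refine (hfΦ _ _).trans ?_
        gcongr
        exact rpow_mul_rpow_le ha.le (by linarith) (by positivity) (by positivity) hA₀ hB₀
    _ = C * (interpDist θs a ε x y * (a * ((∫ s, ‖x' s - y' s‖ ^ 2 ∂ρ) / ‖x - y‖ ^ 2) +
          (1 - a) * ((∫ s, ‖x' s - θs‖ ^ 2 ∂ρ + ∫ s, ‖y' s - θs‖ ^ 2 ∂ρ + ε) /
            (‖x - θs‖ ^ 2 + ‖y - θs‖ ^ 2 + ε)))) := by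
        rw [integral_const_mul, integral_const_mul, integral_add i1 i2, integral_const_mul,
          integral_const_mul, integral_div, integral_div, integral_add ixy (integrable_const _),
          integral_add ix iy]
        simp
    _ ≤ C * (interpDist θs a ε x y * κ) := by
        have := interpDist_nonneg θs (a := a) hε.le x y
        gcongr
        exact hκ x y hxy
    _ = _ := by ring

lemma quadGrowth_iterate_transition (h : AttractingField ρ F θs L m) (μ : ℝ) {f : E → ℝ}
    (hf : QuadGrowth θs f) (n : ℕ) : QuadGrowth θs ((transition ρ F μ)^[n] f) := by
  induction n with
  | zero => exact hf
  | succ n ih => rw [Function.iterate_succ_apply']; exact h.quadGrowth_transition μ ih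

/-- The chain is ergodic for small steps: expectations of functions with the local regularity of
quadratic forms converge, and the limit does not depend on the starting point. -/
theorem exists_tendsto_iterate_transition (h : AttractingField ρ F θs L m) :
    ∀ᶠ μ in 𝓝[>] (0 : ℝ), ∀ f : E → ℝ, QuadGrowth θs f →
      (∃ C, 0 ≤ C ∧ ∀ x y, |f x - f y| ≤ C * (‖x - y‖ * (‖x - θs‖ + ‖y - θs‖))) →
      ∃ l : ℝ, ∀ x, Tendsto (fun n => (transition ρ F μ)^[n] f x) atTop (𝓝 l) := by
  obtain ⟨a, ε, ha, ha2, hε, hev⟩ := h.exists_interpDist_contraction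
  filter_upwards [hev] with μ ⟨κ, hκ0, hκ1, hκ⟩ f hf ⟨C, hC, hfC⟩
  have hprob := h.prob
  have hiter : ∀ n x y, |(transition ρ F μ)^[n] f x - (transition ρ F μ)^[n] f y| ≤
      (2 * C * κ ^ n) * interpDist θs a ε x y := by
    intro n
    induction n with
    | zero =>
      intro x y
      have h1 := mul_le_mul_of_nonneg_left (norm_sub_mul_le_interpDist θs ha.le ha2 hε x y) hC
      have h2 := hfC x y
      simp only [Function.iterate_zero, id_eq, pow_zero, mul_one]
      linarith
    | succ n ih =>
      intro x y
      rw [Function.iterate_succ_apply', pow_succ, ← mul_assoc]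
      exact hκ _ _ (by positivity) (h.quadGrowth_iterate_transition μ hf n) ih x y
  -- The next iterate at `x` averages the current one over a single step from `x`, so consecutive
  -- values differ by `O(κ ^ n)`.
  have hcauchy : ∀ x, ∃ l, Tendsto (fun n => (transition ρ F μ)^[n] f x) atTop (𝓝 l) := by
    intro x
    have ix : Integrable (fun s => ‖fieldStep F μ x s - θs‖ ^ 2) ρ :=
      integrable_norm_sq_of_memLp (h.memLp_step_sub μ x)
    have iM : Integrable (fun s => 3 * (‖x - θs‖ ^ 2 + ‖fieldStep F μ x s - θs‖ ^ 2) + ε) ρ :=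
      (((integrable_const _).add ix).const_mul 3).add (integrable_const _)
    set M := ∫ s, (3 * (‖x - θs‖ ^ 2 + ‖fieldStep F μ x s - θs‖ ^ 2) + ε) ∂ρ
    have hbound : ∀ y, interpDist θs a ε x y ≤ 3 * (‖x - θs‖ ^ 2 + ‖y - θs‖ ^ 2) + ε := by
      intro y
      have h1 := rpow_mul_rpow_le ha.le (by linarith : a ≤ 1) (sq_nonneg ‖x - y‖)
        (by positivity : 0 ≤ ‖x - θs‖ ^ 2 + ‖y - θs‖ ^ 2 + ε) one_pos one_pos
      simp only [Real.one_rpow, one_mul, div_one] at h1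
      have h2 : ‖x - y‖ ≤ ‖x - θs‖ + ‖y - θs‖ := by
        have : x - y = (x - θs) - (y - θs) := by abel
        rw [this]; exact norm_sub_le _ _
      have h3 : ‖x - y‖ ^ 2 ≤ 2 * (‖x - θs‖ ^ 2 + ‖y - θs‖ ^ 2) := by
        have : ‖x - y‖ ^ 2 ≤ (‖x - θs‖ + ‖y - θs‖) ^ 2 := by gcongr
        nlinarith [sq_nonneg (‖x - θs‖ - ‖y - θs‖)]
      have h4 : a * ‖x - y‖ ^ 2 ≤ 1 * ‖x - y‖ ^ 2 := by gcongr; linarith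
      have h5 : 0 ≤ a * (‖x - θs‖ ^ 2 + ‖y - θs‖ ^ 2 + ε) := by positivity
      unfold interpDist
      linarith
    have hc : CauchySeq (fun n => (transition ρ F μ)^[n] f x) := by
      refine cauchySeq_of_le_geometric κ (2 * C * M) hκ1 fun n => ?_
      have hg := h.quadGrowth_iterate_transition μ hf n
      set g := (transition ρ F μ)^[n] f with hgdef
      have ig := h.integrable_comp_step μ hg x
      rw [Function.iterate_succ_apply', Real.dist_eq, ← hgdef]
      calc |g x - transition ρ F μ g x| = |∫ s, (g x - g (fieldStep F μ x s)) ∂ρ| := by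
            rw [integral_sub (integrable_const _) ig, transition]; simp
        _ ≤ ∫ s, |g x - g (fieldStep F μ x s)| ∂ρ := abs_integral_le_integral_abs
        _ ≤ ∫ s, (2 * C * κ ^ n) *
              (3 * (‖x - θs‖ ^ 2 + ‖fieldStep F μ x s - θs‖ ^ 2) + ε) ∂ρ := by
            refine integral_mono ((integrable_const _).sub ig).abs (iM.const_mul _) fun s => ?_
            exact (hiter n _ _).trans (by gcongr; exact hbound _)
        _ = 2 * C * M * κ ^ n := by rw [integral_const_mul]; ring
    exact cauchySeq_tendsto_of_complete hc
  obtain ⟨l, hl⟩ := hcauchy θs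
  refine ⟨l, fun x => ?_⟩
  have hdiff : Tendsto (fun n => (transition ρ F μ)^[n] f x - (transition ρ F μ)^[n] f θs)
      atTop (𝓝 0) := by
    refine squeeze_zero_norm (fun n => hiter n x θs) ?_
    simpa using ((tendsto_pow_atTop_nhds_zero_of_lt_one hκ0 hκ1).const_mul (2 * C)).mul_const
      (interpDist θs a ε x θs)
  simpa using hdiff.add hl

end AttractingField

end Contraction

/-! ### Scalar recursions and the test function `v²/(1 + v)` -/

section Scalar

/-- The excess over the fixed point `b/k` decays geometrically. The recursion is required only
eventually, since its coefficients will come from asymptotic bounds. -/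
lemma eventually_le_of_affine_recursion {a : ℕ → ℝ} {k b δ : ℝ} (hk : 0 < k) (hk1 : k ≤ 1)
    (hδ : 0 < δ) (ha : ∀ᶠ n in atTop, a (n + 1) ≤ (1 - k) * a n + b) :
    ∀ᶠ n in atTop, a n ≤ b / k + δ := by
  obtain ⟨N, hN⟩ := eventually_atTop.1 ha
  have hgeom : ∀ j, a (j + N) - b / k ≤ (1 - k) ^ j * (a N - b / k) := by
    intro j
    induction j with
    | zero => simp
    | succ j ih =>
      have h1 := hN (j + N) (by omega)
      have h2 := mul_le_mul_of_nonneg_left ih (sub_nonneg.2 hk1)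
      have h3 : k * (b / k) = b := by field_simp
      rw [show j + 1 + N = j + N + 1 by omega, pow_succ']
      linarith
  have hlim : Tendsto (fun j => (1 - k) ^ j * (a N - b / k)) atTop (𝓝 0) := by
    simpa using (tendsto_pow_atTop_nhds_zero_of_lt_one (sub_nonneg.2 hk1)
      (by linarith)).mul_const (a N - b / k)
  obtain ⟨M, hM⟩ := eventually_atTop.1 (hlim.eventually_lt_const hδ)
  refine eventually_atTop.2 ⟨M + N, fun n hn => ?_⟩
  obtain ⟨j, rfl⟩ : ∃ j, n = j + N := ⟨n - N, by omega⟩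
  have := hgeom j
  have := hM j (by omega)
  linarith

lemma eventually_mul_lt (c : ℝ) {b : ℝ} (hb : 0 < b) : ∀ᶠ μ in 𝓝[>] (0 : ℝ), c * μ < b := by
  have : Tendsto (fun μ : ℝ => c * μ) (𝓝[>] 0) (𝓝 (c * 0)) :=
    (Continuous.tendsto (by fun_prop) 0).mono_left nhdsWithin_le_nhds
  exact this.eventually_lt_const (by simpa using hb)

/-- A convex function which is quadratic near `0` and linear at infinity. -/
def linQuad (v : ℝ) : ℝ := v ^ 2 / (1 + v)

lemma linQuad_nonneg {v : ℝ} (hv : 0 ≤ v) : 0 ≤ linQuad v := by unfold linQuad; positivity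

lemma linQuad_le {v : ℝ} (hv : 0 ≤ v) : linQuad v ≤ v := by
  unfold linQuad; rw [div_le_iff₀ (by positivity)]; nlinarith

/-- First-order Taylor expansion with exact remainder, from `v²/(1 + v) = v - 1 + 1/(1 + v)`. The
factor `1 + w` under the remainder is what later tames large jumps. -/
lemma linQuad_eq_add {v w : ℝ} (hv : 0 ≤ v) (hw : 0 ≤ w) :
    linQuad w = linQuad v + (1 - 1 / (1 + v) ^ 2) * (w - v) +
      (w - v) ^ 2 / ((1 + w) * (1 + v) ^ 2) := by
  unfold linQuad; field_simp; ring

/-- `y² / (1 + y/2)` is almost subadditive. -/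
lemma sq_div_add_le {y p q : ℝ} (hy : 0 ≤ y) (hp : 0 ≤ p) (hq : 0 ≤ q) (hypq : y ≤ p + q) :
    y ^ 2 / (1 + y / 2) ≤ (2 * p) ^ 2 / (1 + p) + 4 * q := by
  have hmono : ∀ z, y ≤ z → y ^ 2 / (1 + y / 2) ≤ z ^ 2 / (1 + z / 2) := by
    intro z hz
    have hz0 := hy.trans hz
    rw [div_le_div_iff₀ (by positivity) (by positivity)]
    have h1 : y * z * y ≤ y * z * z := by gcongr
    nlinarith
  rcases le_total q p with hqp | hpq
  · have h1 := hmono (2 * p) (by linarith)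
    rw [mul_div_cancel_left₀ _ two_ne_zero] at h1
    linarith
  · have h1 := hmono (2 * q) (by linarith)
    have h2 : (2 * q) ^ 2 / (1 + (2 * q) / 2) ≤ 4 * q := by
      rw [div_le_iff₀ (by positivity)]; nlinarith
    have h3 : 0 ≤ (2 * p) ^ 2 / (1 + p) := by positivity
    linarith

variable {E : Type*} [NormedAddCommGroup E] [InnerProductSpace ℝ E]

/-- The Taylor remainder contains `‖μ f‖⁴`, which need not be integrable. Dividing by a denominator
that grows with `‖μ f‖²` makes it at most linear in `‖f‖²`; then `f` is split into the noise `f₀` at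
`θs` and the Lipschitz increment `f - f₀`. -/
lemma linQuad_norm_sq_sub_smul_le (u f f₀ : E) (μ : ℝ) :
    linQuad (‖u - μ • f‖ ^ 2) ≤ linQuad (‖u‖ ^ 2) +
      (1 - 1 / (1 + ‖u‖ ^ 2) ^ 2) * (‖u - μ • f‖ ^ 2 - ‖u‖ ^ 2) +
      μ ^ 2 * (16 * ‖u‖ ^ 2 * ‖f₀‖ ^ 2 + 32 * ‖f - f₀‖ ^ 2 +
        2 * (16 * μ ^ 2 * (‖f₀‖ ^ 2) ^ 2 / (1 + 2 * μ ^ 2 * ‖f₀‖ ^ 2))) := by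
  set v := ‖u‖ ^ 2 with hv
  set w := ‖u - μ • f‖ ^ 2 with hw
  set A := ‖f₀‖ ^ 2 with hA
  set b := ‖f - f₀‖ ^ 2 with hb
  set y := μ ^ 2 * ‖f‖ ^ 2 with hy
  have hv0 : 0 ≤ v := by positivity
  have hw0 : 0 ≤ w := by positivity
  have hA0 : 0 ≤ A := by positivity
  have hb0 : 0 ≤ b := by positivity
  have hy0 : 0 ≤ y := by positivity
  have hnf : ‖μ • f‖ ^ 2 = y := by rw [norm_smul, mul_pow, Real.norm_eq_abs, sq_abs]
  have hf : ‖f‖ ^ 2 ≤ 2 * A + 2 * b := by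
    have h1 : ‖f‖ ≤ ‖f₀‖ + ‖f - f₀‖ := by simpa using norm_add_le f₀ (f - f₀)
    have h2 : ‖f‖ ^ 2 ≤ (‖f₀‖ + ‖f - f₀‖) ^ 2 := by gcongr
    nlinarith [sq_nonneg (‖f₀‖ - ‖f - f₀‖)]
  have hyAb : y ≤ 2 * μ ^ 2 * A + 2 * μ ^ 2 * b := by
    have := mul_le_mul_of_nonneg_left hf (sq_nonneg μ)
    linarith
  have hdiff : (w - v) ^ 2 ≤ 8 * v * y + 2 * y ^ 2 := by
    have h1 : w - v = -2 * inner ℝ u (μ • f) + y := by rw [hw, norm_sub_sq_real, hnf]; ring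
    have h2 : inner ℝ u (μ • f) ^ 2 ≤ v * y := by
      rw [← hnf, hv, ← mul_pow, ← sq_abs]
      gcongr
      exact abs_real_inner_le_norm _ _
    rw [h1]
    nlinarith [sq_nonneg (2 * inner ℝ u (μ • f) + y)]
  -- A large jump forces the old or the new position to be large: `y ≤ 2 v + 2 w`.
  have hden : 1 + y / 2 ≤ (1 + w) * (1 + v) := by
    have h1 : ‖μ • f‖ ≤ ‖u‖ + ‖u - μ • f‖ := by
      have : μ • f = u - (u - μ • f) := by abel
      calc ‖μ • f‖ = ‖u - (u - μ • f)‖ := by rw [← this]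
        _ ≤ _ := norm_sub_le _ _
    have h2 : y ≤ (‖u‖ + ‖u - μ • f‖) ^ 2 := by rw [← hnf]; gcongr
    have h3 : y ≤ 2 * v + 2 * w := by nlinarith [sq_nonneg (‖u‖ - ‖u - μ • f‖)]
    nlinarith [mul_nonneg hw0 hv0]
  have hrem : (w - v) ^ 2 / ((1 + w) * (1 + v) ^ 2) ≤
      8 * v / (1 + v) ^ 2 * y + 2 * (y ^ 2 / (1 + y / 2)) := by
    calc (w - v) ^ 2 / ((1 + w) * (1 + v) ^ 2)
        ≤ (8 * v * y + 2 * y ^ 2) / ((1 + w) * (1 + v) ^ 2) := by gcongr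
      _ = 8 * v * y / ((1 + w) * (1 + v) ^ 2) + 2 * (y ^ 2 / ((1 + w) * (1 + v) ^ 2)) := by ring
      _ ≤ 8 * v * y / (1 * (1 + v) ^ 2) + 2 * (y ^ 2 / (1 + y / 2)) := by
          gcongr
          · linarith
          · refine hden.trans ?_
            rw [pow_two, ← mul_assoc]
            exact le_mul_of_one_le_right (by positivity) (by linarith)
      _ = _ := by rw [one_mul]; ring
  have hψ := sq_div_add_le hy0 (by positivity : 0 ≤ 2 * μ ^ 2 * A)
    (by positivity : 0 ≤ 2 * μ ^ 2 * b) hyAb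
  have hfirst : 8 * v / (1 + v) ^ 2 * y ≤ μ ^ 2 * (16 * v * A + 16 * b) := by
    have h1 : 8 * v / (1 + v) ^ 2 ≤ 8 * v := div_le_self (by positivity) (by nlinarith)
    have h2 : 8 * v / (1 + v) ^ 2 ≤ 8 := by
      rw [div_le_iff₀ (by positivity)]; nlinarith
    calc 8 * v / (1 + v) ^ 2 * y
        ≤ 8 * v / (1 + v) ^ 2 * (2 * μ ^ 2 * A + 2 * μ ^ 2 * b) := by gcongr
      _ = 8 * v / (1 + v) ^ 2 * (2 * μ ^ 2 * A) + 8 * v / (1 + v) ^ 2 * (2 * μ ^ 2 * b) := by ring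
      _ ≤ 8 * v * (2 * μ ^ 2 * A) + 8 * (2 * μ ^ 2 * b) := by gcongr
      _ = _ := by ring
  have he : (2 * (2 * μ ^ 2 * A)) ^ 2 / (1 + 2 * μ ^ 2 * A) =
      μ ^ 2 * (16 * μ ^ 2 * A ^ 2 / (1 + 2 * μ ^ 2 * A)) := by ring
  rw [linQuad_eq_add hv0 hw0]
  linarith

end Scalar

/-! ### Fluctuations around the attracting point -/

section Fluctuations

variable {S E : Type*} [MeasurableSpace S] [NormedAddCommGroup E] [InnerProductSpace ℝ E]
  [FiniteDimensional ℝ E] [MeasurableSpace E] [BorelSpace E]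

/-- The contribution of large values of the noise at `θs`, for the step `μ`. -/
def noiseTail (ρ : Measure S) (F : S → E → E) (θs : E) (μ : ℝ) : ℝ :=
  ∫ s, 16 * μ ^ 2 * (‖F s θs‖ ^ 2) ^ 2 / (1 + 2 * μ ^ 2 * ‖F s θs‖ ^ 2) ∂ρ

lemma quadGrowth_linQuad (θs : E) : QuadGrowth θs (fun x => linQuad (‖x - θs‖ ^ 2)) :=
  QuadGrowth.of_le (by unfold linQuad; fun_prop) (QuadGrowth.sq θs) fun x => by
    rw [abs_of_nonneg (linQuad_nonneg (by positivity))]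
    exact linQuad_le (by positivity)

variable {ρ : Measure S} {F : S → E → E} {θs : E} {L m : ℝ}

namespace AttractingField

lemma measurable_field (h : AttractingField ρ F θs L m) (x : E) : Measurable (fun s => F s x) :=
  h.meas.comp measurable_prodMk_right

lemma noiseTail_integrand_le (μ : ℝ) (s : S) :
    16 * μ ^ 2 * (‖F s θs‖ ^ 2) ^ 2 / (1 + 2 * μ ^ 2 * ‖F s θs‖ ^ 2) ≤ 8 * ‖F s θs‖ ^ 2 := by
  rw [div_le_iff₀ (by positivity)]
  nlinarith [sq_nonneg ‖F s θs‖]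

lemma integrable_noiseTail (h : AttractingField ρ F θs L m) (μ : ℝ) :
    Integrable (fun s => 16 * μ ^ 2 * (‖F s θs‖ ^ 2) ^ 2 / (1 + 2 * μ ^ 2 * ‖F s θs‖ ^ 2)) ρ := by
  have hm := h.measurable_field θs
  refine ((integrable_norm_sq_of_memLp (h.mom θs)).const_mul 8).mono'
    (Measurable.aestronglyMeasurable (by fun_prop)) (ae_of_all _ fun s => ?_)
  rw [Real.norm_of_nonneg (by positivity)]
  exact noiseTail_integrand_le μ s

/-- Dominated convergence: the integrand vanishes pointwise as `μ → 0` and is at most `8 ‖F s θs‖²`.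
-/
lemma tendsto_noiseTail (h : AttractingField ρ F θs L m) :
    Tendsto (noiseTail ρ F θs) (𝓝[>] 0) (𝓝 0) := by
  have hz : (0 : ℝ) = ∫ _, (0 : ℝ) ∂ρ := by simp
  rw [hz]
  refine tendsto_integral_filter_of_dominated_convergence (fun s => 8 * ‖F s θs‖ ^ 2)
    (Eventually.of_forall fun μ => (h.integrable_noiseTail μ).aestronglyMeasurable)
    (Eventually.of_forall fun μ => ae_of_all _ fun s => ?_)
    ((integrable_norm_sq_of_memLp (h.mom θs)).const_mul 8) (ae_of_all _ fun s => ?_)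
  · rw [Real.norm_of_nonneg (by positivity)]
    exact noiseTail_integrand_le μ s
  · have hc : Continuous fun μ : ℝ =>
        16 * μ ^ 2 * (‖F s θs‖ ^ 2) ^ 2 / (1 + 2 * μ ^ 2 * ‖F s θs‖ ^ 2) :=
      Continuous.div (by fun_prop) (by fun_prop) fun μ => by positivity
    simpa using (hc.tendsto 0).mono_left nhdsWithin_le_nhds

/-- With `D` the derivative of the test function at `v`, the bound `linQuad v ≤ D v` turns the drift
into decay at rate `2 m μ`, while `D ≤ 2 v` and `D ≤ 1` make the first-order noise `O(μ² v)`. -/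
lemma transition_linQuad_le (h : AttractingField ρ F θs L m) {μ : ℝ} (hμ : 0 ≤ μ) (x : E) :
    transition ρ F μ (fun y => linQuad (‖y - θs‖ ^ 2)) x ≤
      (1 - 2 * m * μ) * linQuad (‖x - θs‖ ^ 2) +
        μ ^ 2 * ((20 * noiseLevel ρ F θs + 34 * L ^ 2) * ‖x - θs‖ ^ 2 +
          2 * noiseTail ρ F θs μ) := by
  have hprob := h.prob
  have hN : 0 ≤ noiseLevel ρ F θs := noiseLevel_nonneg
  have hm := h.pos
  set u := x - θs with hu
  set v := ‖u‖ ^ 2 with hv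
  have hv0 : 0 ≤ v := by positivity
  set D := 1 - 1 / (1 + v) ^ 2 with hD
  have hD0 : 0 ≤ D := by
    have : 1 / (1 + v) ^ 2 ≤ 1 := (div_le_one (by positivity)).2 (by nlinarith)
    linarith
  have hD1 : D ≤ 1 := by
    have : 0 ≤ 1 / (1 + v) ^ 2 := by positivity
    linarith
  have hD2 : D ≤ 2 * v := by
    have : 1 - 2 * v ≤ 1 / (1 + v) ^ 2 := by
      rw [le_div_iff₀ (by positivity)]
      nlinarith [mul_nonneg hv0 hv0, mul_nonneg (mul_nonneg hv0 hv0) hv0]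
    linarith
  have hDv : linQuad v ≤ D * v := by
    have : D * v - linQuad v = v ^ 2 / (1 + v) ^ 2 := by rw [hD, linQuad]; field_simp; ring
    have : 0 ≤ v ^ 2 / (1 + v) ^ 2 := by positivity
    linarith
  have hstep : ∀ s, fieldStep F μ x s - θs = u - μ • F s x := by
    intro s; simp only [fieldStep, hu]; abel
  have i1 : Integrable (fun s => ‖fieldStep F μ x s - θs‖ ^ 2) ρ :=
    integrable_norm_sq_of_memLp (h.memLp_step_sub μ x)
  have i1' : Integrable (fun s => D * (‖fieldStep F μ x s - θs‖ ^ 2 - v)) ρ :=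
    (i1.sub (integrable_const _)).const_mul D
  have i2 : Integrable (fun s => 16 * v * ‖F s θs‖ ^ 2) ρ :=
    (integrable_norm_sq_of_memLp (h.mom θs)).const_mul _
  have i3 : Integrable (fun s => 32 * ‖F s x - F s θs‖ ^ 2) ρ :=
    (integrable_norm_sq_of_memLp ((h.mom x).sub (h.mom θs))).const_mul _
  have i4 := (h.integrable_noiseTail μ).const_mul 2
  have i23 : Integrable (fun s => 16 * v * ‖F s θs‖ ^ 2 + 32 * ‖F s x - F s θs‖ ^ 2) ρ :=
    i2.add i3
  have i234 : Integrable (fun s => 16 * v * ‖F s θs‖ ^ 2 + 32 * ‖F s x - F s θs‖ ^ 2 +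
      2 * (16 * μ ^ 2 * (‖F s θs‖ ^ 2) ^ 2 / (1 + 2 * μ ^ 2 * ‖F s θs‖ ^ 2))) ρ := i23.add i4
  have i5 : Integrable (fun s => μ ^ 2 * (16 * v * ‖F s θs‖ ^ 2 + 32 * ‖F s x - F s θs‖ ^ 2 +
      2 * (16 * μ ^ 2 * (‖F s θs‖ ^ 2) ^ 2 / (1 + 2 * μ ^ 2 * ‖F s θs‖ ^ 2)))) ρ :=
    i234.const_mul _
  have i6 : Integrable (fun s => linQuad v + D * (‖fieldStep F μ x s - θs‖ ^ 2 - v)) ρ :=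
    (integrable_const _).add i1'
  have hle : transition ρ F μ (fun y => linQuad (‖y - θs‖ ^ 2)) x ≤
      ∫ s, (linQuad v + D * (‖fieldStep F μ x s - θs‖ ^ 2 - v) +
        μ ^ 2 * (16 * v * ‖F s θs‖ ^ 2 + 32 * ‖F s x - F s θs‖ ^ 2 +
        2 * (16 * μ ^ 2 * (‖F s θs‖ ^ 2) ^ 2 / (1 + 2 * μ ^ 2 * ‖F s θs‖ ^ 2)))) ∂ρ := by
    refine integral_mono (h.integrable_comp_step μ (quadGrowth_linQuad θs) x) (i6.add i5)
      fun s => ?_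
    have := linQuad_norm_sq_sub_smul_le u (F s x) (F s θs) μ
    simpa only [hstep s] using this
  have heq : ∫ s, (linQuad v + D * (‖fieldStep F μ x s - θs‖ ^ 2 - v) +
        μ ^ 2 * (16 * v * ‖F s θs‖ ^ 2 + 32 * ‖F s x - F s θs‖ ^ 2 +
        2 * (16 * μ ^ 2 * (‖F s θs‖ ^ 2) ^ 2 / (1 + 2 * μ ^ 2 * ‖F s θs‖ ^ 2)))) ∂ρ =
      linQuad v + D * (∫ s, ‖fieldStep F μ x s - θs‖ ^ 2 ∂ρ - v) +
        μ ^ 2 * (16 * v * noiseLevel ρ F θs + 32 * ∫ s, ‖F s x - F s θs‖ ^ 2 ∂ρ +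
          2 * noiseTail ρ F θs μ) := by
    rw [integral_add i6 i5, integral_add (integrable_const _) i1', integral_const_mul,
      integral_sub i1 (integrable_const _), integral_const_mul, integral_add i23 i4,
      integral_add i2 i3, integral_const_mul, integral_const_mul, integral_const_mul]
    simp [noiseTail, noiseLevel]
  have hdrift : ∫ s, ‖fieldStep F μ x s - θs‖ ^ 2 ∂ρ - v ≤
      -(2 * m * μ) * v + μ ^ 2 * (2 * noiseLevel ρ F θs + 2 * L ^ 2 * v) := by
    rw [h.integral_norm_step_sq]
    have h1 := mul_le_mul_of_nonneg_left (h.integral_norm_sq_le x) (sq_nonneg μ)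
    have h2 := mul_le_mul_of_nonneg_left (h.attr' x) hμ
    linarith
  have h1 := mul_le_mul_of_nonneg_left hdrift hD0
  have h2 : μ ^ 2 * noiseLevel ρ F θs * D ≤ μ ^ 2 * noiseLevel ρ F θs * (2 * v) := by gcongr
  have h3 : μ ^ 2 * (2 * L ^ 2 * v) * D ≤ μ ^ 2 * (2 * L ^ 2 * v) * 1 := by gcongr
  have h4 : 2 * m * μ * linQuad v ≤ 2 * m * μ * (D * v) := by gcongr
  have h5 := mul_le_mul_of_nonneg_left (h.lip x θs) (sq_nonneg μ)
  rw [heq] at hle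
  linarith

/-- The one-step estimate is an affine recursion with fixed point `2 N μ / m`, where `N` is the
noise level; the summand `1` is slack for the transient. -/
lemma eventually_integral_norm_sq_le (h : AttractingField ρ F θs L m) :
    ∀ᶠ μ in 𝓝[>] (0 : ℝ), ∀ x, ∀ᶠ n in atTop,
      ∫ y, ‖y - θs‖ ^ 2 ∂(chainLaw ρ F μ x n) ≤ (2 * noiseLevel ρ F θs / m + 1) * μ := by
  have hm := h.pos
  filter_upwards [self_mem_nhdsWithin, eventually_mul_lt (2 * L ^ 2) hm,
    eventually_mul_lt m one_pos] with μ hμ hμ1 hμ2 x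
  have hμ : 0 < μ := hμ
  have hrec : ∀ n, ∫ y, ‖y - θs‖ ^ 2 ∂(chainLaw ρ F μ x (n + 1)) ≤
      (1 - m * μ) * ∫ y, ‖y - θs‖ ^ 2 ∂(chainLaw ρ F μ x n) +
        2 * μ ^ 2 * noiseLevel ρ F θs := by
    intro n
    have := h.isProbabilityMeasure_chainLaw μ x n
    have hq := h.integrable_chainLaw μ x n (QuadGrowth.sq θs)
    rw [h.integral_chainLaw_succ μ x n (QuadGrowth.sq θs)]
    calc _ ≤ ∫ y, ((1 - m * μ) * ‖y - θs‖ ^ 2 + 2 * μ ^ 2 * noiseLevel ρ F θs)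
          ∂(chainLaw ρ F μ x n) :=
          integral_mono (h.integrable_chainLaw μ x n
            (h.quadGrowth_transition μ (QuadGrowth.sq θs)))
            ((hq.const_mul _).add (integrable_const _)) fun y =>
            h.integral_norm_step_sq_le hμ.le (by linarith) y
      _ = _ := by
          rw [integral_add (hq.const_mul _) (integrable_const _), integral_const_mul]; simp
  filter_upwards [eventually_le_of_affine_recursion
    (a := fun n => ∫ y, ‖y - θs‖ ^ 2 ∂(chainLaw ρ F μ x n)) (by positivity : 0 < m * μ) hμ2.le hμ
    (Eventually.of_forall hrec)] with n hn
  refine hn.trans (le_of_eq ?_)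
  field_simp

/-- The forcing term is `μ²` times `c 𝔼‖x - θs‖² = O(μ)` plus the vanishing noise tail; divided by
the rate `2 m μ` it is `o(μ)`. Half of `η μ` is the fixed point, the other half slack. -/
lemma eventually_integral_linQuad_le (h : AttractingField ρ F θs L m) {η : ℝ} (hη : 0 < η) :
    ∀ᶠ μ in 𝓝[>] (0 : ℝ), ∀ x, ∀ᶠ n in atTop,
      ∫ y, linQuad (‖y - θs‖ ^ 2) ∂(chainLaw ρ F μ x n) ≤ η * μ := by
  have hm := h.pos
  have hN : 0 ≤ noiseLevel ρ F θs := noiseLevel_nonneg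
  set c := 20 * noiseLevel ρ F θs + 34 * L ^ 2 with hc
  have hc0 : 0 ≤ c := by positivity
  set c₁ := 2 * noiseLevel ρ F θs / m + 1 with hc₁
  filter_upwards [self_mem_nhdsWithin, eventually_mul_lt (2 * m) one_pos,
    h.eventually_integral_norm_sq_le, eventually_mul_lt (c * c₁) (by positivity : 0 < m * η / 2),
    h.tendsto_noiseTail.eventually_lt_const (by positivity : 0 < m * η / 4)] with
    μ hμ hμ1 hsq hμ2 htail x
  have hμ : 0 < μ := hμ
  have hrec : ∀ᶠ n in atTop, ∫ y, linQuad (‖y - θs‖ ^ 2) ∂(chainLaw ρ F μ x (n + 1)) ≤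
      (1 - 2 * m * μ) * ∫ y, linQuad (‖y - θs‖ ^ 2) ∂(chainLaw ρ F μ x n) +
        μ ^ 2 * (m * η) := by
    filter_upwards [hsq x] with n hn
    have := h.isProbabilityMeasure_chainLaw μ x n
    have hq := h.integrable_chainLaw μ x n (quadGrowth_linQuad θs)
    have hV := h.integrable_chainLaw μ x n (QuadGrowth.sq θs)
    have hV' : Integrable (fun y => μ ^ 2 * (c * ‖y - θs‖ ^ 2 + 2 * noiseTail ρ F θs μ))
      (chainLaw ρ F μ x n) := ((hV.const_mul c).add (integrable_const _)).const_mul _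
    rw [h.integral_chainLaw_succ μ x n (quadGrowth_linQuad θs)]
    calc _ ≤ ∫ y, ((1 - 2 * m * μ) * linQuad (‖y - θs‖ ^ 2) +
            μ ^ 2 * (c * ‖y - θs‖ ^ 2 + 2 * noiseTail ρ F θs μ)) ∂(chainLaw ρ F μ x n) :=
          integral_mono (h.integrable_chainLaw μ x n
            (h.quadGrowth_transition μ (quadGrowth_linQuad θs)))
            ((hq.const_mul _).add hV') fun y => h.transition_linQuad_le hμ.le y
      _ = (1 - 2 * m * μ) * ∫ y, linQuad (‖y - θs‖ ^ 2) ∂(chainLaw ρ F μ x n) +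
            μ ^ 2 * (c * ∫ y, ‖y - θs‖ ^ 2 ∂(chainLaw ρ F μ x n) +
              2 * noiseTail ρ F θs μ) := by
          rw [integral_add (hq.const_mul _) hV', integral_const_mul, integral_const_mul,
            integral_add (hV.const_mul c) (integrable_const _), integral_const_mul]
          simp
      _ ≤ _ := by
          have h1 := mul_le_mul_of_nonneg_left hn hc0
          gcongr
          linarith
  filter_upwards [eventually_le_of_affine_recursion
    (a := fun n => ∫ y, linQuad (‖y - θs‖ ^ 2) ∂(chainLaw ρ F μ x n))
    (by positivity : 0 < 2 * m * μ) hμ1.le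
    (by positivity : 0 < η * μ / 2) hrec] with n hn
  refine hn.trans (le_of_eq ?_)
  field_simp
  ring

/-- Near `θs` differentiability gives the term with `η`. At distance at least `r` the error is
`O(v)` with `v = ‖x - θs‖²`, and there `v ≤ (1 + 1/r²) linQuad v`. -/
lemma exists_linearization_error_le (h : AttractingField ρ F θs L m) {η : ℝ} (hη : 0 < η) :
    ∃ c, 0 ≤ c ∧ ∀ x, ‖x - θs‖ * ‖meanField ρ F x - fderiv ℝ (meanField ρ F) θs (x - θs)‖ ≤
      η * ‖x - θs‖ ^ 2 + c * linQuad (‖x - θs‖ ^ 2) := by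
  have hL := h.L_pos
  have h1 := h.hasStrictFDerivAt.hasFDerivAt.isLittleO.def hη
  rw [Metric.eventually_nhds_iff] at h1
  obtain ⟨r, hr, hball⟩ := h1
  set C := fderiv ℝ (meanField ρ F) θs
  refine ⟨(L + ‖C‖) * (1 + 1 / r ^ 2), by positivity, fun x => ?_⟩
  have hq := linQuad_nonneg (sq_nonneg ‖x - θs‖)
  by_cases hx : ‖x - θs‖ < r
  · have h2 := hball (y := x) (by rwa [dist_eq_norm])
    rw [h.meanField_eq_zero, sub_zero] at h2
    have h3 := mul_le_mul_of_nonneg_left h2 (norm_nonneg (x - θs))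
    have : 0 ≤ (L + ‖C‖) * (1 + 1 / r ^ 2) * linQuad (‖x - θs‖ ^ 2) := by positivity
    linarith
  · rw [not_lt] at hx
    set v := ‖x - θs‖ ^ 2 with hv
    have hrv : r ^ 2 ≤ v := by rw [hv]; gcongr
    have hv0 : 0 < v := lt_of_lt_of_le (by positivity) hrv
    have h2 : ‖meanField ρ F x - C (x - θs)‖ ≤ (L + ‖C‖) * ‖x - θs‖ := by
      refine (norm_sub_le _ _).trans ?_
      have := h.norm_meanField_le x
      have := C.le_opNorm (x - θs)
      linarith
    have h3 := mul_le_mul_of_nonneg_left h2 (norm_nonneg (x - θs))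
    have h4 : v ≤ (1 + 1 / r ^ 2) * linQuad v := by
      have h5 : 1 / v ≤ 1 / r ^ 2 := by gcongr
      have h6 : v = (1 + 1 / v) * linQuad v := by unfold linQuad; field_simp; ring
      calc v = (1 + 1 / v) * linQuad v := h6
        _ ≤ _ := by gcongr
    have h7 : (L + ‖C‖) * v ≤ (L + ‖C‖) * ((1 + 1 / r ^ 2) * linQuad v) := by gcongr
    have h8 : 0 ≤ η * v := by positivity
    nlinarith

end AttractingField

end Fluctuations

/-! ### Recursion for the second moments -/

section Bilinear

variable {S E : Type*} [MeasurableSpace S] [NormedAddCommGroup E] [InnerProductSpace ℝ E]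
  [FiniteDimensional ℝ E] [MeasurableSpace E] [BorelSpace E]

lemma abs_inner_mul_inner_le (p q u v : E) :
    |inner ℝ p u * inner ℝ q v| ≤ ‖p‖ * ‖q‖ * (‖u‖ * ‖v‖) := by
  rw [abs_mul]
  calc _ ≤ (‖p‖ * ‖u‖) * (‖q‖ * ‖v‖) := by
        gcongr <;> exact abs_real_inner_le_norm _ _
    _ = _ := by ring

lemma quadGrowth_inner_mul_inner (θs p q : E) (B : E →L[ℝ] E) :
    QuadGrowth θs (fun x => inner ℝ p (x - θs) * inner ℝ q (B (x - θs))) :=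
  QuadGrowth.of_le (by fun_prop) ((QuadGrowth.sq θs).const_mul (‖p‖ * ‖q‖ * ‖B‖)) fun x => by
    refine (abs_inner_mul_inner_le _ _ _ _).trans ?_
    calc _ ≤ ‖p‖ * ‖q‖ * (‖x - θs‖ * (‖B‖ * ‖x - θs‖)) := by gcongr; exact B.le_opNorm _
      _ = _ := by ring

lemma quadGrowth_inner_mul_inner' (θs p q : E) :
    QuadGrowth θs (fun x => inner ℝ p (x - θs) * inner ℝ q (x - θs)) := by
  simpa using quadGrowth_inner_mul_inner θs p q (ContinuousLinearMap.id ℝ E)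

lemma integrable_inner_mul_inner {ρ : Measure S} {f g : S → E} (hf : MemLp f 2 ρ)
    (hg : MemLp g 2 ρ) (p q : E) : Integrable (fun s => inner ℝ p (f s) * inner ℝ q (g s)) ρ :=
  (hf.const_inner p).integrable_mul (hg.const_inner q)

variable {ρ : Measure S} {F : S → E → E} {θs : E} {L m : ℝ}

/-- The covariance form of the noise at `x`. -/
def noiseForm (ρ : Measure S) (F : S → E → E) (p q x : E) : ℝ :=
  ∫ s, inner ℝ p (F s x) * inner ℝ q (F s x) ∂ρ

namespace AttractingField

lemma transition_inner_mul_inner (h : AttractingField ρ F θs L m) (μ : ℝ) (p q x : E) :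
    transition ρ F μ (fun y => inner ℝ p (y - θs) * inner ℝ q (y - θs)) x =
      inner ℝ p (x - θs) * inner ℝ q (x - θs) -
        μ * (inner ℝ p (x - θs) * inner ℝ q (meanField ρ F x) +
          inner ℝ p (meanField ρ F x) * inner ℝ q (x - θs)) + μ ^ 2 * noiseForm ρ F p q x := by
  have hprob := h.prob
  have hi : Integrable (fun s => F s x) ρ := (h.mom x).integrable (by norm_num)
  set u := x - θs with hu
  have hexp : ∀ s, inner ℝ p (fieldStep F μ x s - θs) * inner ℝ q (fieldStep F μ x s - θs) =
      inner ℝ p u * inner ℝ q u - μ * (inner ℝ p u * inner ℝ q (F s x) +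
        inner ℝ q u * inner ℝ p (F s x)) + μ ^ 2 * (inner ℝ p (F s x) * inner ℝ q (F s x)) := by
    intro s
    have : fieldStep F μ x s - θs = u - μ • F s x := by simp only [fieldStep, hu]; abel
    rw [this]
    clear_value u
    simp only [inner_sub_right, inner_smul_right]
    ring
  have i1 : Integrable (fun s => inner ℝ p u * inner ℝ q (F s x)) ρ :=
    (hi.const_inner q).const_mul _
  have i2 : Integrable (fun s => inner ℝ q u * inner ℝ p (F s x)) ρ :=
    (hi.const_inner p).const_mul _
  have i3 : Integrable (fun s => μ * (inner ℝ p u * inner ℝ q (F s x) +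
      inner ℝ q u * inner ℝ p (F s x))) ρ := (i1.add i2).const_mul _
  have i4 : Integrable (fun s => inner ℝ p u * inner ℝ q u - μ * (inner ℝ p u * inner ℝ q (F s x) +
      inner ℝ q u * inner ℝ p (F s x))) ρ := (integrable_const _).sub i3
  have i5 := (integrable_inner_mul_inner (h.mom x) (h.mom x) p q).const_mul (μ ^ 2)
  simp only [transition, hexp]
  rw [integral_add i4 i5, integral_sub (integrable_const _) i3, integral_const, integral_const_mul,
    integral_add i1 i2, integral_const_mul, integral_const_mul, integral_const_mul,
    integral_inner hi, integral_inner hi]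
  simp only [probReal_univ, one_smul, noiseForm, meanField]
  ring

/-- Expanding around `F s θs` leaves cross terms, split by Young's inequality with weight `η`. -/
lemma abs_noiseForm_sub_le (h : AttractingField ρ F θs L m) {η : ℝ} (hη : 0 < η) (p q x : E) :
    |noiseForm ρ F p q x - noiseForm ρ F p q θs| ≤
      ‖p‖ * ‖q‖ * ((1 + 1 / η) * (L ^ 2 * ‖x - θs‖ ^ 2) + η * noiseLevel ρ F θs) := by
  have hprob := h.prob
  have i1 := integrable_inner_mul_inner (h.mom x) (h.mom x) p q
  have i2 := integrable_inner_mul_inner (h.mom θs) (h.mom θs) p q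
  have i3 : Integrable (fun s => (1 + 1 / η) * ‖F s x - F s θs‖ ^ 2) ρ :=
    (integrable_norm_sq_of_memLp ((h.mom x).sub (h.mom θs))).const_mul _
  have i4 : Integrable (fun s => η * ‖F s θs‖ ^ 2) ρ :=
    (integrable_norm_sq_of_memLp (h.mom θs)).const_mul _
  have hpt : ∀ s, |inner ℝ p (F s x) * inner ℝ q (F s x) -
      inner ℝ p (F s θs) * inner ℝ q (F s θs)| ≤
      ‖p‖ * ‖q‖ * ((1 + 1 / η) * ‖F s x - F s θs‖ ^ 2 + η * ‖F s θs‖ ^ 2) := by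
    intro s
    set f := F s x
    set g := F s θs
    have e : inner ℝ p f * inner ℝ q f - inner ℝ p g * inner ℝ q g =
        inner ℝ p (f - g) * inner ℝ q (f - g) + inner ℝ p (f - g) * inner ℝ q g +
          inner ℝ p g * inner ℝ q (f - g) := by
      simp only [inner_sub_right]; ring
    have h1 := abs_inner_mul_inner_le p q (f - g) (f - g)
    have h2 := abs_inner_mul_inner_le p q (f - g) g
    have h3 := abs_inner_mul_inner_le p q g (f - g)
    have h4 : 2 * (‖f - g‖ * ‖g‖) ≤ 1 / η * ‖f - g‖ ^ 2 + η * ‖g‖ ^ 2 := by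
      have h5 : 0 ≤ 1 / η * (‖f - g‖ - η * ‖g‖) ^ 2 := by positivity
      have h6 : 1 / η * (‖f - g‖ - η * ‖g‖) ^ 2 =
        1 / η * ‖f - g‖ ^ 2 + η * ‖g‖ ^ 2 - 2 * (‖f - g‖ * ‖g‖) := by field_simp; ring
      linarith
    have h7 : 0 ≤ ‖p‖ * ‖q‖ := by positivity
    have h8 := mul_le_mul_of_nonneg_left h4 h7
    rw [e]
    refine (abs_add_le _ _).trans ?_
    have := abs_add_le (inner ℝ p (f - g) * inner ℝ q (f - g)) (inner ℝ p (f - g) * inner ℝ q g)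
    linarith
  rw [noiseForm, noiseForm, ← integral_sub i1 i2]
  calc _ ≤ ∫ s, |inner ℝ p (F s x) * inner ℝ q (F s x) -
          inner ℝ p (F s θs) * inner ℝ q (F s θs)| ∂ρ := abs_integral_le_integral_abs
    _ ≤ ∫ s, ‖p‖ * ‖q‖ * ((1 + 1 / η) * ‖F s x - F s θs‖ ^ 2 + η * ‖F s θs‖ ^ 2) ∂ρ :=
        integral_mono (i1.sub i2).abs ((i3.add i4).const_mul _) hpt
    _ = ‖p‖ * ‖q‖ * ((1 + 1 / η) * ∫ s, ‖F s x - F s θs‖ ^ 2 ∂ρ + η * noiseLevel ρ F θs) := by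
        rw [integral_const_mul, integral_add i3 i4, integral_const_mul, integral_const_mul,
          noiseLevel]
    _ ≤ _ := by
        gcongr
        exact h.lip x θs

/-- The linearized drift of the form `⟪p, ·⟫ ⟪q, ·⟫`. -/
def _root_.driftForm (B : E →L[ℝ] E) (θs p q x : E) : ℝ :=
  inner ℝ p (x - θs) * inner ℝ q (B (x - θs)) + inner ℝ q (x - θs) * inner ℝ p (B (x - θs))

lemma _root_.quadGrowth_driftForm (B : E →L[ℝ] E) (θs p q : E) :
    QuadGrowth θs (driftForm B θs p q) :=
  (quadGrowth_inner_mul_inner θs p q B).add (quadGrowth_inner_mul_inner θs q p B)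

lemma abs_transition_sub_le (h : AttractingField ρ F θs L m) {η : ℝ} (hη : 0 < η) (p q : E) :
    ∃ c, 0 ≤ c ∧ ∀ μ, 0 < μ → ∀ x,
      |transition ρ F μ (fun y => inner ℝ p (y - θs) * inner ℝ q (y - θs)) x -
        inner ℝ p (x - θs) * inner ℝ q (x - θs) +
        μ * driftForm (fderiv ℝ (meanField ρ F) θs) θs p q x - μ ^ 2 * noiseForm ρ F p q θs| ≤
      ‖p‖ * ‖q‖ * (2 * μ * (η * ‖x - θs‖ ^ 2 + c * linQuad (‖x - θs‖ ^ 2)) +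
        μ ^ 2 * ((1 + 1 / η) * (L ^ 2 * ‖x - θs‖ ^ 2) + η * noiseLevel ρ F θs)) := by
  obtain ⟨c, hc, hlin⟩ := h.exists_linearization_error_le hη
  refine ⟨c, hc, fun μ hμ x => ?_⟩
  have h0 := hlin x
  set u := x - θs
  set C := fderiv ℝ (meanField ρ F) θs
  set e := meanField ρ F x - C u with he
  have h1 := abs_inner_mul_inner_le p q u e
  have h2 := abs_inner_mul_inner_le p q e u
  have h3 := h.abs_noiseForm_sub_le hη p q x
  rw [h.transition_inner_mul_inner]
  have hexp : inner ℝ p u * inner ℝ q u - μ * (inner ℝ p u * inner ℝ q (meanField ρ F x) +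
        inner ℝ p (meanField ρ F x) * inner ℝ q u) + μ ^ 2 * noiseForm ρ F p q x -
        inner ℝ p u * inner ℝ q u + μ * driftForm C θs p q x - μ ^ 2 * noiseForm ρ F p q θs =
      μ ^ 2 * (noiseForm ρ F p q x - noiseForm ρ F p q θs) -
        μ * (inner ℝ p u * inner ℝ q e + inner ℝ p e * inner ℝ q u) := by
    have : meanField ρ F x = e + C u := by rw [he]; abel
    rw [this, driftForm]
    simp only [inner_add_right]
    ring
  rw [hexp]
  have h4 : |μ ^ 2 * (noiseForm ρ F p q x - noiseForm ρ F p q θs)| ≤ μ ^ 2 * (‖p‖ * ‖q‖ *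
      ((1 + 1 / η) * (L ^ 2 * ‖u‖ ^ 2) + η * noiseLevel ρ F θs)) := by
    rw [abs_mul, abs_of_nonneg (sq_nonneg μ)]; gcongr
  have h5 : |μ * (inner ℝ p u * inner ℝ q e + inner ℝ p e * inner ℝ q u)| ≤
      μ * (2 * (‖p‖ * ‖q‖ * (‖u‖ * ‖e‖))) := by
    rw [abs_mul, abs_of_nonneg hμ.le]
    gcongr
    refine (abs_add_le _ _).trans ?_
    linarith [mul_comm ‖u‖ ‖e‖]
  have h6 : μ * (2 * (‖p‖ * ‖q‖ * (‖u‖ * ‖e‖))) ≤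
      μ * (2 * (‖p‖ * ‖q‖ * (η * ‖u‖ ^ 2 + c * linQuad (‖u‖ ^ 2)))) := by gcongr
  refine (abs_sub _ _).trans ?_
  linarith

/-- Up to `o(μ²)`, the second moments of the chain satisfy the linearized recursion. -/
lemma eventually_abs_recursion_error_le (h : AttractingField ρ F θs L m) (p q : E) {δ : ℝ}
    (hδ : 0 < δ) :
    ∀ᶠ μ in 𝓝[>] (0 : ℝ), ∀ x, ∀ᶠ n in atTop,
      |∫ y, inner ℝ p (y - θs) * inner ℝ q (y - θs) ∂(chainLaw ρ F μ x (n + 1)) -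
        ∫ y, inner ℝ p (y - θs) * inner ℝ q (y - θs) ∂(chainLaw ρ F μ x n) +
        μ * ∫ y, driftForm (fderiv ℝ (meanField ρ F) θs) θs p q y ∂(chainLaw ρ F μ x n) -
        μ ^ 2 * noiseForm ρ F p q θs| ≤ δ * μ ^ 2 := by
  have hm := h.pos
  have hN : 0 ≤ noiseLevel ρ F θs := noiseLevel_nonneg
  set N := noiseLevel ρ F θs
  set c₁ := 2 * N / m + 1 with hc₁
  have hc₁0 : 0 < c₁ := by positivity
  -- Once the asymptotic bounds are inserted, the total error is exactly `η P μ²`.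
  set P := ‖p‖ * ‖q‖ * (2 * c₁ + 3 + N) with hP
  have hP0 : 0 ≤ P := by positivity
  set η := δ / (P + 1) with hηdef
  have hη : 0 < η := by positivity
  have hηP : η * P ≤ δ := by
    rw [hηdef, div_mul_eq_mul_div, div_le_iff₀ (by positivity)]; linarith
  obtain ⟨c, hc, hR⟩ := h.abs_transition_sub_le hη p q
  filter_upwards [self_mem_nhdsWithin, h.eventually_integral_norm_sq_le,
    h.eventually_integral_linQuad_le (by positivity : 0 < η / (c + 1)),
    eventually_mul_lt ((1 + 1 / η) * L ^ 2 * c₁) hη] with μ hμ hsq hlq hμ1 x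
  have hμ : 0 < μ := hμ
  filter_upwards [hsq x, hlq x] with n hn1 hn2
  have hprob := h.isProbabilityMeasure_chainLaw μ x n
  set f : E → ℝ := fun y => inner ℝ p (y - θs) * inner ℝ q (y - θs) with hf
  have gf : QuadGrowth θs f := quadGrowth_inner_mul_inner' θs p q
  set D := driftForm (fderiv ℝ (meanField ρ F) θs) θs p q
  have gD : QuadGrowth θs D := quadGrowth_driftForm _ θs p q
  have if1 := h.integrable_chainLaw μ x n (h.quadGrowth_transition μ gf)
  have if0 := h.integrable_chainLaw μ x n gf
  have iD := (h.integrable_chainLaw μ x n gD).const_mul μ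
  have iV := h.integrable_chainLaw μ x n (QuadGrowth.sq θs)
  have iq := h.integrable_chainLaw μ x n (quadGrowth_linQuad θs)
  have i1 : Integrable (fun y => transition ρ F μ f y - f y) (chainLaw ρ F μ x n) := if1.sub if0
  have i2 : Integrable (fun y => transition ρ F μ f y - f y + μ * D y) (chainLaw ρ F μ x n) :=
    i1.add iD
  have i3 : Integrable (fun y => η * ‖y - θs‖ ^ 2 + c * linQuad (‖y - θs‖ ^ 2))
    (chainLaw ρ F μ x n) := (iV.const_mul _).add (iq.const_mul _)
  have i4 : Integrable (fun y => (1 + 1 / η) * (L ^ 2 * ‖y - θs‖ ^ 2) + η * N)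
    (chainLaw ρ F μ x n) := ((iV.const_mul _).const_mul _).add (integrable_const _)
  have i34 : Integrable (fun y => 2 * μ * (η * ‖y - θs‖ ^ 2 + c * linQuad (‖y - θs‖ ^ 2)) +
      μ ^ 2 * ((1 + 1 / η) * (L ^ 2 * ‖y - θs‖ ^ 2) + η * N)) (chainLaw ρ F μ x n) :=
    (i3.const_mul _).add (i4.const_mul _)
  rw [h.integral_chainLaw_succ μ x n gf]
  have heq : ∫ y, transition ρ F μ f y ∂(chainLaw ρ F μ x n) - ∫ y, f y ∂(chainLaw ρ F μ x n) +
      μ * ∫ y, D y ∂(chainLaw ρ F μ x n) - μ ^ 2 * noiseForm ρ F p q θs =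
      ∫ y, (transition ρ F μ f y - f y + μ * D y - μ ^ 2 * noiseForm ρ F p q θs)
        ∂(chainLaw ρ F μ x n) := by
    rw [integral_sub i2 (integrable_const _), integral_add i1 iD, integral_sub if1 if0,
      integral_const_mul]
    simp
  rw [heq]
  calc _ ≤ ∫ y, |transition ρ F μ f y - f y + μ * D y - μ ^ 2 * noiseForm ρ F p q θs|
        ∂(chainLaw ρ F μ x n) := abs_integral_le_integral_abs
    _ ≤ ∫ y, ‖p‖ * ‖q‖ * (2 * μ * (η * ‖y - θs‖ ^ 2 + c * linQuad (‖y - θs‖ ^ 2)) +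
      μ ^ 2 * ((1 + 1 / η) * (L ^ 2 * ‖y - θs‖ ^ 2) + η * N)) ∂(chainLaw ρ F μ x n) :=
        integral_mono (i2.sub (integrable_const _)).abs (i34.const_mul _) (hR μ hμ)
    _ = ‖p‖ * ‖q‖ * (2 * μ * (η * ∫ y, ‖y - θs‖ ^ 2 ∂(chainLaw ρ F μ x n) +
          c * ∫ y, linQuad (‖y - θs‖ ^ 2) ∂(chainLaw ρ F μ x n)) +
        μ ^ 2 * ((1 + 1 / η) * (L ^ 2 * ∫ y, ‖y - θs‖ ^ 2 ∂(chainLaw ρ F μ x n)) + η * N)) := by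
        rw [integral_const_mul, integral_add (i3.const_mul _) (i4.const_mul _),
          integral_const_mul, integral_const_mul,
          integral_add (iV.const_mul _) (iq.const_mul _),
          integral_add ((iV.const_mul _).const_mul _) (integrable_const _), integral_const_mul,
          integral_const_mul, integral_const_mul, integral_const_mul]
        simp
    _ ≤ ‖p‖ * ‖q‖ * (2 * μ * (η * (c₁ * μ) + c * (η / (c + 1) * μ)) +
        μ ^ 2 * ((1 + 1 / η) * (L ^ 2 * (c₁ * μ)) + η * N)) := by gcongr
    _ ≤ ‖p‖ * ‖q‖ * (2 * μ * (η * (c₁ * μ) + η * μ) + μ ^ 2 * (η + η * N)) := by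
        have h1 : c * (η / (c + 1) * μ) ≤ η * μ := by
          have : c * (η / (c + 1)) ≤ η := by
            rw [mul_div_assoc', div_le_iff₀ (by positivity)]; linarith
          calc _ = c * (η / (c + 1)) * μ := by ring
            _ ≤ _ := by gcongr
        have h2 : (1 + 1 / η) * (L ^ 2 * (c₁ * μ)) ≤ η := by linarith
        gcongr
    _ = η * P * μ ^ 2 := by rw [hP]; ring
    _ ≤ _ := by gcongr

end AttractingField

end Bilinear

/-! ### The Lyapunov operator -/

section Lyapunov

variable {d : ℕ}

/-- The Lyapunov operator `M ↦ C M + M Cᵀ`. -/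
def lyapunovOp (C : Matrix (Fin d) (Fin d) ℝ) :
    Matrix (Fin d) (Fin d) ℝ →ₗ[ℝ] Matrix (Fin d) (Fin d) ℝ :=
  LinearMap.mulLeft ℝ C + LinearMap.mulRight ℝ C.transpose

lemma lyapunovOp_apply (C M : Matrix (Fin d) (Fin d) ℝ) :
    lyapunovOp C M = C * M + M * C.transpose := rfl

/-- Pairing `C M + M Cᵀ` entrywise with `M` gives the quadratic form of `C` summed over the columns
and over the rows of `M`. Both sums are nonnegative, and coercivity on the rows forces `M = 0`. -/
lemma lyapunovOp_injective {C : Matrix (Fin d) (Fin d) ℝ} {m : ℝ} (hm : 0 < m)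
    (hC : ∀ u : Fin d → ℝ, m * (u ⬝ᵥ u) ≤ u ⬝ᵥ C.mulVec u) :
    Function.Injective (lyapunovOp C) := by
  rw [← LinearMap.ker_eq_bot, LinearMap.ker_eq_bot']
  intro M hM
  have h0 : ∑ i, ∑ j, M i j * (lyapunovOp C M) i j = 0 := by simp [hM]
  have hcol : ∑ i, ∑ j, M i j * (C * M) i j = ∑ j, M.col j ⬝ᵥ C.mulVec (M.col j) := by
    rw [Finset.sum_comm]
    rfl
  have hrow : ∑ i, ∑ j, M i j * (M * C.transpose) i j = ∑ i, M i ⬝ᵥ C.mulVec (M i) := by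
    refine Finset.sum_congr rfl fun i _ => Finset.sum_congr rfl fun j _ => ?_
    congr 1
    simp only [Matrix.mul_apply, Matrix.transpose_apply, Matrix.mulVec, dotProduct]
    exact Finset.sum_congr rfl fun k _ => mul_comm _ _
  have hsplit : ∑ i, ∑ j, M i j * (lyapunovOp C M) i j =
      ∑ j, M.col j ⬝ᵥ C.mulVec (M.col j) + ∑ i, M i ⬝ᵥ C.mulVec (M i) := by
    rw [← hcol, ← hrow, ← Finset.sum_add_distrib]
    refine Finset.sum_congr rfl fun i _ => ?_
    rw [← Finset.sum_add_distrib]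
    refine Finset.sum_congr rfl fun j _ => ?_
    rw [lyapunovOp_apply, Matrix.add_apply, mul_add]
  have hself : ∀ u : Fin d → ℝ, 0 ≤ u ⬝ᵥ u := fun u =>
    Finset.sum_nonneg fun i _ => mul_self_nonneg _
  have h1 : 0 ≤ ∑ j, M.col j ⬝ᵥ C.mulVec (M.col j) :=
    Finset.sum_nonneg fun j _ => (mul_nonneg hm.le (hself _)).trans (hC _)
  have h2 : ∑ i, m * (M i ⬝ᵥ M i) ≤ ∑ i, M i ⬝ᵥ C.mulVec (M i) :=
    Finset.sum_le_sum fun i _ => hC _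
  rw [← Finset.mul_sum] at h2
  have h3 : ∑ i, (M i ⬝ᵥ M i) ≤ 0 := by
    by_contra! hpos
    have := mul_pos hm hpos
    linarith
  have h4 := (Finset.sum_eq_zero_iff_of_nonneg fun i _ => hself (M i)).1
    (le_antisymm h3 (Finset.sum_nonneg fun i _ => hself (M i)))
  ext i j
  have h5 := dotProduct_self_eq_zero.1 (h4 i (Finset.mem_univ i))
  exact congrFun h5 j

lemma tendsto_of_tendsto_lyapunovOp {C : Matrix (Fin d) (Fin d) ℝ}
    (hC : Function.Injective (lyapunovOp C)) {ι : Type*} {l : Filter ι}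
    {V : ι → Matrix (Fin d) (Fin d) ℝ} {Q : Matrix (Fin d) (Fin d) ℝ}
    (hV : Tendsto (fun i => lyapunovOp C (V i)) l (𝓝 (lyapunovOp C Q))) :
    Tendsto V l (𝓝 Q) := by
  set e := LinearEquiv.ofInjectiveEndo (lyapunovOp C) hC with he
  have hcont : Continuous e.symm := e.symm.toLinearMap.continuous_of_finiteDimensional
  have happ : ∀ M, e.symm (lyapunovOp C M) = M := fun M => by
    rw [LinearEquiv.symm_apply_eq]; rfl
  have h := (hcont.tendsto _).comp hV
  simpa only [Function.comp_def, happ] using h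

lemma fderiv_apply_eq_sum (g : EuclideanSpace ℝ (Fin d) → EuclideanSpace ℝ (Fin d))
    (θ u : EuclideanSpace ℝ (Fin d)) (i : Fin d) :
    (fderiv ℝ g θ u) i = ∑ k, jacobianMatrix g θ i k * u k := by
  have hu : u = ∑ k, u k • EuclideanSpace.single k (1 : ℝ) := by
    ext j
    simp [Finset.sum_apply, Pi.single_apply]
  conv_lhs => rw [hu]
  simp only [map_sum, map_smul, jacobianMatrix, Matrix.of_apply]
  simp [mul_comm]

end Lyapunov

/-! ### Stationary second moments and their small-step limit -/

section Covariance

variable {S : Type*} [MeasurableSpace S] {d : ℕ} {ρ : Measure S}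
  {F : S → EuclideanSpace ℝ (Fin d) → EuclideanSpace ℝ (Fin d)}
  {θs : EuclideanSpace ℝ (Fin d)} {L m : ℝ}

lemma inner_single_one (i : Fin d) (u : EuclideanSpace ℝ (Fin d)) :
    inner ℝ (EuclideanSpace.single i (1 : ℝ)) u = u i := by
  simp [EuclideanSpace.inner_single_left]

lemma quadGrowth_apply_mul_apply (θs : EuclideanSpace ℝ (Fin d)) (i j : Fin d) :
    QuadGrowth θs (fun x => (x - θs) i * (x - θs) j) := by
  simpa only [inner_single_one] using quadGrowth_inner_mul_inner' θs
    (EuclideanSpace.single i (1 : ℝ)) (EuclideanSpace.single j (1 : ℝ))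

namespace AttractingField

lemma lyapunovOp_jacobianMatrix_injective (h : AttractingField ρ F θs L m) :
    Function.Injective (lyapunovOp (jacobianMatrix (meanField ρ F) θs)) := by
  refine lyapunovOp_injective h.pos fun u => ?_
  have h1 := h.coercive (WithLp.toLp 2 u)
  rw [← real_inner_self_eq_norm_sq] at h1
  simp only [PiLp.inner_apply, fderiv_apply_eq_sum] at h1
  simpa [dotProduct, Matrix.mulVec, mul_comm, pow_two] using h1

/-- The quadratic forms `x ↦ (x - θs)_i (x - θs)_j` satisfy the regularity assumption of
`exists_tendsto_iterate_transition`. -/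
lemma apply_mul_apply_sub_le (i j : Fin d) (x y : EuclideanSpace ℝ (Fin d)) :
    |(x - θs) i * (x - θs) j - (y - θs) i * (y - θs) j| ≤
      1 * (‖x - y‖ * (‖x - θs‖ + ‖y - θs‖)) := by
  have hxy : x - y = (x - θs) - (y - θs) := by abel
  rw [hxy]
  set u := x - θs
  set v := y - θs
  have e : u i * u j - v i * v j = (u - v) i * u j + v i * (u - v) j := by
    simp only [PiLp.sub_apply]; ring
  have hn : ∀ (w : EuclideanSpace ℝ (Fin d)) k, |w k| ≤ ‖w‖ := fun w k => PiLp.norm_apply_le w k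
  rw [e, one_mul, mul_add]
  refine (abs_add_le _ _).trans (add_le_add ?_ ?_)
  · rw [abs_mul]; gcongr <;> exact hn _ _
  · rw [abs_mul, mul_comm]; gcongr <;> exact hn _ _

lemma integral_driftForm (h : AttractingField ρ F θs L m) (μ : ℝ)
    (x : EuclideanSpace ℝ (Fin d)) (n : ℕ) (i j : Fin d) :
    ∫ y, driftForm (fderiv ℝ (meanField ρ F) θs) θs (EuclideanSpace.single i 1)
        (EuclideanSpace.single j 1) y ∂(chainLaw ρ F μ x n) =
      lyapunovOp (jacobianMatrix (meanField ρ F) θs)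
        (secondMoment (chainLaw ρ F μ x n) (fun y => y - θs)) i j := by
  set J := jacobianMatrix (meanField ρ F) θs with hJ
  have hi : ∀ a b, Integrable (fun y => (y - θs) a * (y - θs) b) (chainLaw ρ F μ x n) :=
    fun a b => h.integrable_chainLaw μ x n (quadGrowth_apply_mul_apply θs a b)
  have hexp : ∀ y, driftForm (fderiv ℝ (meanField ρ F) θs) θs (EuclideanSpace.single i 1)
        (EuclideanSpace.single j 1) y =
      ∑ k, J i k * ((y - θs) k * (y - θs) j) + ∑ k, (y - θs) i * (y - θs) k * J j k := by
    intro y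
    simp only [driftForm, inner_single_one, fderiv_apply_eq_sum, ← hJ, Finset.mul_sum]
    rw [add_comm]
    congr 1 <;> exact Finset.sum_congr rfl fun k _ => by ring
  simp only [hexp]
  rw [integral_add (integrable_finsetSum _ fun k _ => (hi k j).const_mul _)
    (integrable_finsetSum _ fun k _ => (hi i k).mul_const _),
    integral_finsetSum _ fun k _ => (hi k j).const_mul _,
    integral_finsetSum _ fun k _ => (hi i k).mul_const _]
  simp only [integral_const_mul, integral_mul_const, lyapunovOp_apply, Matrix.add_apply,
    Matrix.mul_apply, Matrix.transpose_apply, secondMoment, Matrix.of_apply]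

/-- For small steps the second moment matrix of the chain converges, to a limit which does not
depend on the starting point and is asymptotically proportional to the step. -/
theorem exists_stationary_secondMoment (h : AttractingField ρ F θs L m) :
    ∃ V : ℝ → Matrix (Fin d) (Fin d) ℝ,
      (∀ᶠ μ in 𝓝[>] (0 : ℝ), ∀ x, Tendsto
        (fun n => secondMoment (chainLaw ρ F μ x n) (fun y => y - θs)) atTop (𝓝 (V μ))) ∧
      ∀ Q, SolvesLyapunov (jacobianMatrix (meanField ρ F) θs)
          (secondMoment ρ (fun s => F s θs)) Q →
        Tendsto (fun μ : ℝ => μ⁻¹ • V μ) (𝓝[>] 0) (𝓝 Q) := by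
  set J := jacobianMatrix (meanField ρ F) θs with hJ
  set V : ℝ → Matrix (Fin d) (Fin d) ℝ := fun μ => Matrix.of fun i j => limUnder atTop fun n =>
    (transition ρ F μ)^[n] (fun x => (x - θs) i * (x - θs) j) θs with hV
  have hlim : ∀ᶠ μ in 𝓝[>] (0 : ℝ), ∀ x, Tendsto
      (fun n => secondMoment (chainLaw ρ F μ x n) (fun y => y - θs)) atTop (𝓝 (V μ)) := by
    filter_upwards [h.exists_tendsto_iterate_transition] with μ hμ x
    refine tendsto_pi_nhds.2 fun i => tendsto_pi_nhds.2 fun j => ?_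
    obtain ⟨l, hl⟩ := hμ (fun x => (x - θs) i * (x - θs) j) (quadGrowth_apply_mul_apply θs i j)
      ⟨1, zero_le_one, apply_mul_apply_sub_le i j⟩
    have hVl : V μ i j = l := (hl θs).limUnder_eq
    rw [hVl]
    refine (hl x).congr fun n => ?_
    rw [← h.integral_chainLaw μ x n (quadGrowth_apply_mul_apply θs i j)]
    rfl
  refine ⟨V, hlim, fun Q hQ => ?_⟩
  refine tendsto_of_tendsto_lyapunovOp h.lyapunovOp_jacobianMatrix_injective ?_
  have hQ' : lyapunovOp J Q = secondMoment ρ (fun s => F s θs) := hQ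
  rw [← hJ, hQ']
  refine tendsto_pi_nhds.2 fun i => tendsto_pi_nhds.2 fun j => ?_
  rw [Metric.tendsto_nhds]
  intro δ hδ
  filter_upwards [self_mem_nhdsWithin, hlim, h.eventually_abs_recursion_error_le
    (EuclideanSpace.single i 1) (EuclideanSpace.single j 1) (half_pos hδ)] with μ hμ hVμ hrec
  have hμ : 0 < μ := hμ
  set M : ℕ → Matrix (Fin d) (Fin d) ℝ :=
    fun n => secondMoment (chainLaw ρ F μ θs n) (fun y => y - θs) with hM
  have hMV : Tendsto M atTop (𝓝 (V μ)) := hVμ θs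
  have hMij : Tendsto (fun n => M n i j) atTop (𝓝 (V μ i j)) :=
    tendsto_pi_nhds.1 (tendsto_pi_nhds.1 hMV i) j
  have hcont : Continuous (lyapunovOp J) := (lyapunovOp J).continuous_of_finiteDimensional
  have hLM : Tendsto (fun n => lyapunovOp J (M n) i j) atTop (𝓝 (lyapunovOp J (V μ) i j)) :=
    tendsto_pi_nhds.1 (tendsto_pi_nhds.1 ((hcont.tendsto _).comp hMV) i) j
  -- In the limit `n → ∞` two consecutive second moments cancel, leaving the Lyapunov equation for
  -- `V μ` up to `o(μ²)`.
  have hbound : |V μ i j - V μ i j + μ * lyapunovOp J (V μ) i j -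
      μ ^ 2 * secondMoment ρ (fun s => F s θs) i j| ≤ δ / 2 * μ ^ 2 := by
    refine le_of_tendsto (((((hMij.comp (tendsto_add_atTop_nat 1)).sub hMij).add
      (hLM.const_mul μ)).sub_const _).abs) ?_
    filter_upwards [hrec θs] with n hn
    rw [h.integral_driftForm] at hn
    simp only [inner_single_one, noiseForm] at hn
    exact hn
  rw [sub_self, zero_add] at hbound
  have hscale : lyapunovOp J (μ⁻¹ • V μ) i j - secondMoment ρ (fun s => F s θs) i j =
      (μ ^ 2)⁻¹ * (μ * lyapunovOp J (V μ) i j - μ ^ 2 * secondMoment ρ (fun s => F s θs) i j) := by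
    rw [map_smul, Matrix.smul_apply, smul_eq_mul]
    field_simp
  rw [Real.dist_eq, hscale, abs_mul, abs_of_pos (by positivity)]
  calc _ ≤ (μ ^ 2)⁻¹ * (δ / 2 * μ ^ 2) := by gcongr
    _ = δ / 2 := by field_simp
    _ < δ := half_lt_self hδ

lemma exists_solvesLyapunov (h : AttractingField ρ F θs L m)
    (Sg : Matrix (Fin d) (Fin d) ℝ) :
    ∃ Q, SolvesLyapunov (jacobianMatrix (meanField ρ F) θs) Sg Q ∧
      ∀ Q', SolvesLyapunov (jacobianMatrix (meanField ρ F) θs) Sg Q' → Q' = Q := by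
  have hinj := h.lyapunovOp_jacobianMatrix_injective
  obtain ⟨Q, hQ⟩ := (LinearMap.injective_iff_surjective.1 hinj) Sg
  exact ⟨Q, hQ, fun Q' hQ' => hinj (Eq.trans hQ' hQ.symm)⟩

end AttractingField

end Covariance

/-! ### Averages of independent copies of the field -/

section BatchField

variable {𝓦 : Type*} [MeasurableSpace 𝓦] {d K : ℕ} {ν : Measure 𝓦}
  {H : 𝓦 → EuclideanSpace ℝ (Fin d) → EuclideanSpace ℝ (Fin d)}

/-- The average of `K` copies of a random field. -/
def batchField (H : 𝓦 → EuclideanSpace ℝ (Fin d) → EuclideanSpace ℝ (Fin d)) (K : ℕ)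
    (ξ : Fin K → 𝓦) (θ : EuclideanSpace ℝ (Fin d)) : EuclideanSpace ℝ (Fin d) :=
  (K : ℝ)⁻¹ • ∑ j, H (ξ j) θ

lemma integral_pi_eval [IsProbabilityMeasure ν] {G : Type*} [NormedAddCommGroup G]
    [NormedSpace ℝ G] {f : 𝓦 → G} (hf : AEStronglyMeasurable f ν) (j : Fin K) :
    ∫ ξ, f (ξ j) ∂(Measure.pi fun _ : Fin K => ν) = ∫ w, f w ∂ν := by
  have hmp := measurePreserving_eval (fun _ : Fin K => ν) j
  have h1 := integral_map hmp.measurable.aemeasurable (hmp.map_eq.symm ▸ hf)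
  rw [hmp.map_eq] at h1
  exact h1.symm

lemma memLp_pi_eval [IsProbabilityMeasure ν] {G : Type*} [NormedAddCommGroup G]
    {f : 𝓦 → G} (hf : MemLp f 2 ν) (j : Fin K) :
    MemLp (fun ξ : Fin K → 𝓦 => f (ξ j)) 2 (Measure.pi fun _ : Fin K => ν) :=
  hf.comp_measurePreserving (measurePreserving_eval (fun _ : Fin K => ν) j)

lemma memLp_batchField [IsProbabilityMeasure ν] (hmom : ∀ θ, MemLp (fun w => H w θ) 2 ν)
    (θ : EuclideanSpace ℝ (Fin d)) :
    MemLp (fun ξ => batchField H K ξ θ) 2 (Measure.pi fun _ : Fin K => ν) := by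
  have h := memLp_finsetSum Finset.univ fun (j : Fin K) _ => memLp_pi_eval (hmom θ) j
  exact h.const_smul ((K : ℝ)⁻¹)

lemma meanField_batchField [IsProbabilityMeasure ν] (hK : 1 ≤ K)
    (hmom : ∀ θ, MemLp (fun w => H w θ) 2 ν) (θ : EuclideanSpace ℝ (Fin d)) :
    meanField (Measure.pi fun _ : Fin K => ν) (batchField H K) θ = ∫ w, H w θ ∂ν := by
  have hK0 : (K : ℝ) ≠ 0 := by positivity
  simp only [meanField, batchField]
  rw [integral_smul, integral_finsetSum _ fun j _ =>
    (memLp_pi_eval (hmom θ) j).integrable (by norm_num)]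
  simp only [integral_pi_eval (hmom θ).1, Finset.sum_const, Finset.card_univ, Fintype.card_fin]
  rw [← Nat.cast_smul_eq_nsmul ℝ, smul_smul, inv_mul_cancel₀ hK0, one_smul]

/-- Cauchy–Schwarz for the average, so the mean-square Lipschitz constant does not depend on `K`. -/
lemma batchField_lip [IsProbabilityMeasure ν] (hK : 1 ≤ K)
    (hmom : ∀ θ, MemLp (fun w => H w θ) 2 ν) (x y : EuclideanSpace ℝ (Fin d)) :
    ∫ ξ, ‖batchField H K ξ x - batchField H K ξ y‖ ^ 2 ∂(Measure.pi fun _ : Fin K => ν) ≤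
      ∫ w, ‖H w x - H w y‖ ^ 2 ∂ν := by
  have hK0 : (0 : ℝ) < K := by positivity
  have hxy : MemLp (fun w => H w x - H w y) 2 ν := (hmom x).sub (hmom y)
  have hpt : ∀ ξ : Fin K → 𝓦, ‖batchField H K ξ x - batchField H K ξ y‖ ^ 2 ≤
      (K : ℝ)⁻¹ * ∑ j, ‖H (ξ j) x - H (ξ j) y‖ ^ 2 := by
    intro ξ
    have e : batchField H K ξ x - batchField H K ξ y =
        (K : ℝ)⁻¹ • ∑ j, (H (ξ j) x - H (ξ j) y) := by
      simp only [batchField, ← smul_sub, Finset.sum_sub_distrib]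
    have h1 : (∑ j, ‖H (ξ j) x - H (ξ j) y‖) ^ 2 ≤ K * ∑ j, ‖H (ξ j) x - H (ξ j) y‖ ^ 2 := by
      simpa using sq_sum_le_card_mul_sum_sq (s := Finset.univ)
        (f := fun j => ‖H (ξ j) x - H (ξ j) y‖)
    rw [e, norm_smul, norm_inv, Real.norm_natCast, mul_pow]
    calc _ ≤ ((K : ℝ)⁻¹) ^ 2 * (∑ j, ‖H (ξ j) x - H (ξ j) y‖) ^ 2 := by
          gcongr; exact norm_sum_le _ _
      _ ≤ ((K : ℝ)⁻¹) ^ 2 * (K * ∑ j, ‖H (ξ j) x - H (ξ j) y‖ ^ 2) := by gcongr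
      _ = _ := by field_simp
  have hi : ∀ j : Fin K, Integrable (fun ξ : Fin K → 𝓦 => ‖H (ξ j) x - H (ξ j) y‖ ^ 2)
      (Measure.pi fun _ : Fin K => ν) := fun j =>
    integrable_norm_sq_of_memLp (memLp_pi_eval hxy j)
  calc _ ≤ ∫ ξ, (K : ℝ)⁻¹ * ∑ j, ‖H (ξ j) x - H (ξ j) y‖ ^ 2
        ∂(Measure.pi fun _ : Fin K => ν) :=
        integral_mono (integrable_norm_sq_of_memLp ((memLp_batchField hmom x).sub
          (memLp_batchField hmom y))) ((integrable_finsetSum _ fun j _ => hi j).const_mul _) hpt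
    _ = _ := by
        rw [integral_const_mul, integral_finsetSum _ fun j _ => hi j]
        simp only [integral_pi_eval (f := fun w => ‖H w x - H w y‖ ^ 2)
          (integrable_norm_sq_of_memLp hxy).1, Finset.sum_const, Finset.card_univ,
          Fintype.card_fin, nsmul_eq_mul]
        field_simp

/-- Off-diagonal products vanish by independence and centring, leaving `K` equal terms divided by
`K²`. -/
lemma secondMoment_batchField [IsProbabilityMeasure ν] (hK : 1 ≤ K)
    (hmom : ∀ θ, MemLp (fun w => H w θ) 2 ν) {θ : EuclideanSpace ℝ (Fin d)}
    (hθ : ∫ w, H w θ ∂ν = 0) :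
    secondMoment (Measure.pi fun _ : Fin K => ν) (fun ξ => batchField H K ξ θ) =
      (K : ℝ)⁻¹ • secondMoment ν (fun w => H w θ) := by
  have hK0 : (K : ℝ) ≠ 0 := by positivity
  have hcoord : ∀ i, MemLp (fun w => (H w θ) i) 2 ν := fun i => by
    simpa only [inner_single_one] using (hmom θ).const_inner (𝕜 := ℝ) (EuclideanSpace.single i (1 : ℝ))
  have hmean : ∀ i, ∫ w, (H w θ) i ∂ν = 0 := fun i => by
    have := integral_inner (𝕜 := ℝ) ((hmom θ).integrable (by norm_num))
      (EuclideanSpace.single i (1 : ℝ))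
    rw [hθ, inner_zero_right] at this
    simpa only [inner_single_one] using this
  ext i l
  have hterm : ∀ j k : Fin K, ∫ ξ : Fin K → 𝓦, (H (ξ j) θ) i * (H (ξ k) θ) l
      ∂(Measure.pi fun _ : Fin K => ν) =
      if j = k then secondMoment ν (fun w => H w θ) i l else 0 := by
    intro j k
    split_ifs with hjk
    · subst hjk
      exact integral_pi_eval (f := fun w => (H w θ) i * (H w θ) l)
        ((hcoord i).integrable_mul (hcoord l)).1 j
    · have hind : IndepFun (fun ξ : Fin K → 𝓦 => (H (ξ j) θ) i) (fun ξ => (H (ξ k) θ) l)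
          (Measure.pi fun _ : Fin K => ν) := by
        have h1 := (iIndepFun_pi (μ := fun _ : Fin K => ν) (X := fun _ => id)
          fun _ => aemeasurable_id).indepFun hjk
        refine h1.comp₀ (φ := fun w => (H w θ) i) (ψ := fun w => (H w θ) l) ?_ ?_ ?_ ?_
        · exact (measurable_pi_apply j).aemeasurable
        · exact (measurable_pi_apply k).aemeasurable
        · have := (measurePreserving_eval (fun _ : Fin K => ν) j).map_eq
          change AEMeasurable _ ((Measure.pi fun _ : Fin K => ν).map (Function.eval j))
          rw [this]
          exact (hcoord i).1.aemeasurable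
        · have := (measurePreserving_eval (fun _ : Fin K => ν) k).map_eq
          change AEMeasurable _ ((Measure.pi fun _ : Fin K => ν).map (Function.eval k))
          rw [this]
          exact (hcoord l).1.aemeasurable
      have h2 := hind.integral_mul_eq_mul_integral (memLp_pi_eval (hcoord i) j).1
        (memLp_pi_eval (hcoord l) k).1
      simp only [Pi.mul_apply] at h2
      rw [h2, integral_pi_eval (f := fun w => (H w θ) i) (hcoord i).1, hmean, zero_mul]
  have hi : ∀ j k : Fin K, Integrable (fun ξ : Fin K → 𝓦 => (H (ξ j) θ) i * (H (ξ k) θ) l)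
      (Measure.pi fun _ : Fin K => ν) := fun j k =>
    (memLp_pi_eval (hcoord i) j).integrable_mul (memLp_pi_eval (hcoord l) k)
  have hexp : ∀ ξ : Fin K → 𝓦, (batchField H K ξ θ) i * (batchField H K ξ θ) l =
      ((K : ℝ)⁻¹) ^ 2 * ∑ j, ∑ k, (H (ξ j) θ) i * (H (ξ k) θ) l := by
    intro ξ
    rw [← Finset.sum_mul_sum]
    simp only [batchField, PiLp.smul_apply, WithLp.ofLp_sum, Finset.sum_apply, smul_eq_mul]
    ring
  rw [Matrix.smul_apply]
  simp only [secondMoment, Matrix.of_apply, hexp] at hterm ⊢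
  rw [integral_const_mul, integral_finsetSum _ fun j _ => integrable_finsetSum _ fun k _ => hi j k]
  simp only [integral_finsetSum _ fun k _ => hi _ k, hterm, Finset.sum_ite_eq, Finset.mem_univ,
    if_true, Finset.sum_const, Finset.card_univ, Fintype.card_fin, nsmul_eq_mul, smul_eq_mul]
  field_simp

lemma attractingField_batchField [IsProbabilityMeasure ν] (hK : 1 ≤ K)
    (hmeas : Measurable (Function.uncurry H)) (hmom : ∀ θ, MemLp (fun w => H w θ) 2 ν)
    {L m : ℝ} (hlip : ∀ x y, ∫ w, ‖H w x - H w y‖ ^ 2 ∂ν ≤ L ^ 2 * ‖x - y‖ ^ 2)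
    {θs : EuclideanSpace ℝ (Fin d)} (hC1 : ContDiffAt ℝ 1 (fun θ => ∫ w, H w θ ∂ν) θs)
    (hm : 0 < m)
    (hattr : ∀ θ, m * ‖θ - θs‖ ^ 2 ≤ inner ℝ (∫ w, H w θ ∂ν) (θ - θs)) :
    AttractingField (Measure.pi fun _ : Fin K => ν) (batchField H K) θs (max |L| m) m := by
  have hmean := meanField_batchField hK hmom
  refine ⟨inferInstance, ?_, memLp_batchField hmom, fun x y => ?_, ?_, hm, le_max_right _ _, ?_⟩
  · have h1 : ∀ j : Fin K, Measurable
        (fun p : (Fin K → 𝓦) × EuclideanSpace ℝ (Fin d) => H (p.1 j) p.2) := fun j =>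
      hmeas.comp (g := Function.uncurry H)
        (f := fun p : (Fin K → 𝓦) × EuclideanSpace ℝ (Fin d) => (p.1 j, p.2)) (((measurable_pi_apply j).comp measurable_fst).prodMk measurable_snd)
    exact (Finset.measurable_fun_sum Finset.univ fun j _ => h1 j).const_smul ((K : ℝ)⁻¹)
  · refine (batchField_lip hK hmom x y).trans ((hlip x y).trans ?_)
    rw [← sq_abs L]
    gcongr
    exact le_max_left _ _
  · have : (fun x => ∫ ξ, batchField H K ξ x ∂(Measure.pi fun _ : Fin K => ν)) =
        fun θ => ∫ w, H w θ ∂ν := funext hmean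
    rwa [this]
  · intro θ
    have := hmean θ
    rw [meanField] at this
    rw [this]
    exact hattr θ

end BatchField

/-! ### Recentring the second moments -/

section Perturbation

variable {S : Type*} [MeasurableSpace S] {d : ℕ} {ρ : Measure S}
  {F : S → EuclideanSpace ℝ (Fin d) → EuclideanSpace ℝ (Fin d)}
  {θs : EuclideanSpace ℝ (Fin d)} {L m : ℝ}

/-- Replacing the centre `θs` by centres converging to it does not change the limit of the second
moment matrices. -/
lemma AttractingField.tendsto_secondMoment_sub (h : AttractingField ρ F θs L m) {μ : ℝ}
    {x : EuclideanSpace ℝ (Fin d)} {V : Matrix (Fin d) (Fin d) ℝ}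
    (hV : Tendsto (fun n => secondMoment (chainLaw ρ F μ x n) (fun y => y - θs)) atTop (𝓝 V))
    {b : ℕ → EuclideanSpace ℝ (Fin d)} (hb : Tendsto b atTop (𝓝 θs)) :
    Tendsto (fun n => secondMoment (chainLaw ρ F μ x n) (fun y => y - b n)) atTop (𝓝 V) := by
  refine tendsto_pi_nhds.2 fun i => tendsto_pi_nhds.2 fun j => ?_
  have hVc : ∀ i j, Tendsto (fun n => ∫ y, (y - θs) i * (y - θs) j ∂(chainLaw ρ F μ x n)) atTop
      (𝓝 (V i j)) := fun i j => tendsto_pi_nhds.1 (tendsto_pi_nhds.1 hV i) j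
  have hbc : ∀ i, Tendsto (fun n => (b n - θs) i) atTop (𝓝 0) := fun i => by
    have h1 : Tendsto (fun n => b n - θs) atTop (𝓝 0) := by
      simpa using hb.sub_const θs
    have h2 : Continuous fun u : EuclideanSpace ℝ (Fin d) => u i := by fun_prop
    exact (h2.tendsto 0).comp h1
  have hq : ∀ i, QuadGrowth θs (fun y => (y - θs) i) := fun i => by
    refine QuadGrowth.of_le (by fun_prop) ((QuadGrowth.const θs 1).add (QuadGrowth.sq θs))
      fun y => ?_
    have h1 : |(y - θs) i| ≤ ‖y - θs‖ := PiLp.norm_apply_le (y - θs) i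
    nlinarith [sq_nonneg (‖y - θs‖ - 1)]
  have hi1 : ∀ n i, Integrable (fun y => (y - θs) i) (chainLaw ρ F μ x n) := fun n i =>
    h.integrable_chainLaw μ x n (hq i)
  have hi2 : ∀ n i j, Integrable (fun y => (y - θs) i * (y - θs) j) (chainLaw ρ F μ x n) :=
    fun n i j => h.integrable_chainLaw μ x n (quadGrowth_apply_mul_apply θs i j)
  -- First moments stay bounded, being controlled by convergent second moments through `|z| ≤ 1 +
  -- z²`, so their products with the vanishing shift tend to zero.
  have hcross : ∀ i j, Tendsto
      (fun n => (∫ y, (y - θs) i ∂(chainLaw ρ F μ x n)) * (b n - θs) j) atTop (𝓝 0) := by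
    intro i j
    refine squeeze_zero_norm (a := fun n =>
      (1 + ∫ y, (y - θs) i * (y - θs) i ∂(chainLaw ρ F μ x n)) * ‖(b n - θs) j‖) (fun n => ?_) ?_
    · have := h.isProbabilityMeasure_chainLaw μ x n
      rw [norm_mul]
      gcongr
      calc ‖∫ y, (y - θs) i ∂(chainLaw ρ F μ x n)‖
          ≤ ∫ y, ‖(y - θs) i‖ ∂(chainLaw ρ F μ x n) := norm_integral_le_integral_norm _
        _ ≤ ∫ y, (1 + (y - θs) i * (y - θs) i) ∂(chainLaw ρ F μ x n) := by
            refine integral_mono (hi1 n i).norm ((integrable_const _).add (hi2 n i i)) fun y => ?_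
            simp only [Real.norm_eq_abs]
            rw [← abs_mul_abs_self ((y - θs) i)]
            nlinarith [sq_nonneg (|(y - θs) i| - 1)]
        _ = _ := by rw [integral_add (integrable_const _) (hi2 n i i)]; simp
    · simpa using ((hVc i i).const_add 1).mul (hbc j).norm
  have hmain := (((hVc i j).sub (hcross i j)).sub (hcross j i)).add ((hbc i).mul (hbc j))
  simp only [sub_zero, mul_zero, add_zero] at hmain
  refine hmain.congr fun n => ?_
  have := h.isProbabilityMeasure_chainLaw μ x n
  have hexp : ∀ y, (y - b n) i * (y - b n) j = (y - θs) i * (y - θs) j -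
      (y - θs) i * (b n - θs) j - (y - θs) j * (b n - θs) i + (b n - θs) i * (b n - θs) j := by
    intro y; simp only [PiLp.sub_apply]; ring
  have j1 := (hi1 n i).mul_const ((b n - θs) j)
  have j2 := (hi1 n j).mul_const ((b n - θs) i)
  have j3 : Integrable (fun y => (y - θs) i * (y - θs) j - (y - θs) i * (b n - θs) j)
    (chainLaw ρ F μ x n) := (hi2 n i j).sub j1
  have j4 : Integrable (fun y => (y - θs) i * (y - θs) j - (y - θs) i * (b n - θs) j -
    (y - θs) j * (b n - θs) i) (chainLaw ρ F μ x n) := j3.sub j2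
  simp only [secondMoment, Matrix.of_apply, hexp]
  rw [integral_add j4 (integrable_const _), integral_sub j3 j2, integral_sub (hi2 n i j) j1,
    integral_mul_const, integral_mul_const]
  simp

lemma AttractingField.memLp_id_chainLaw (h : AttractingField ρ F θs L m) (μ : ℝ)
    (x : EuclideanSpace ℝ (Fin d)) (n : ℕ) : MemLp id 2 (chainLaw ρ F μ x n) := by
  have := h.isProbabilityMeasure_chainLaw μ x n
  have h1 : MemLp (fun y => y - θs) 2 (chainLaw ρ F μ x n) :=
    (memLp_two_iff_integrable_sq_norm (by fun_prop)).2
      (h.integrable_chainLaw μ x n (QuadGrowth.sq θs))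
  convert h1.add (memLp_const θs) using 1
  ext y; simp

end Perturbation

/-! ### Trajectories as realizations of the chain -/

section Trajectories

variable {Ω 𝓦 : Type*} [MeasurableSpace Ω] [MeasurableSpace 𝓦] {d K : ℕ} {P : Measure Ω}
  [IsProbabilityMeasure P] {ν : Measure 𝓦} {W : ℕ → Ω → 𝓦}
  {H : 𝓦 → EuclideanSpace ℝ (Fin d) → EuclideanSpace ℝ (Fin d)}
  {θs : EuclideanSpace ℝ (Fin d)} {L m : ℝ}

/-- The samples used by the batch algorithm for the update number `t + 1`. -/
def batchNoise (W : ℕ → Ω → 𝓦) (K t : ℕ) (ω : Ω) (j : Fin K) : 𝓦 := W ((t + 1) * K - j) ω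

lemma batchDir_succ (H : 𝓦 → EuclideanSpace ℝ (Fin d) → EuclideanSpace ℝ (Fin d))
    (W : ℕ → Ω → 𝓦) (K t : ℕ) (ω : Ω) (θ : EuclideanSpace ℝ (Fin d)) :
    batchDir H W K (t + 1) ω θ = batchField H K (batchNoise W K t ω) θ := by
  simp only [batchDir, batchField, batchNoise, Finset.sum_range]

lemma classicalDir_eq_batchDir (H : 𝓦 → EuclideanSpace ℝ (Fin d) → EuclideanSpace ℝ (Fin d))
    (W : ℕ → Ω → 𝓦) : classicalDir H W = batchDir H W 1 := by
  funext t ω θ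
  simp [classicalDir, batchDir]

lemma measurable_batchNoise (hW : ∀ t, Measurable (W t)) (K t : ℕ) :
    Measurable (batchNoise W K t) :=
  measurable_pi_lambda _ fun _ => hW _

/-- Since `j < K`, the natural subtraction is not truncated and the index stays inside the current
batch; distinctness and disjointness of batch indices rest on this. -/
lemma lt_of_fin_batch (t : ℕ) (j : Fin K) : t * K < (t + 1) * K - j := by
  have := j.2
  rw [add_mul, one_mul]
  omega

lemma map_batchNoise (hW : ∀ t, Measurable (W t)) (hlaw : ∀ t, P.map (W t) = ν)
    (hind : iIndepFun W P) (t : ℕ) :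
    P.map (batchNoise W K t) = Measure.pi fun _ : Fin K => ν := by
  have hinj : Function.Injective fun j : Fin K => (t + 1) * K - (j : ℕ) := by
    intro i j hij
    have h1 := lt_of_fin_batch t i
    have h2 := lt_of_fin_batch t j
    simp only at hij
    exact Fin.ext (by omega)
  have h := (iIndepFun_iff_map_fun_eq_pi_map fun j : Fin K => (hW _).aemeasurable).1
    (hind.precomp hinj)
  simp only [hlaw] at h
  exact h

/-- Adaptedness: after `t` updates the state is a measurable function of the samples up to index `t
* K`, hence independent of the next batch. -/
lemma exists_stochTraj_eq (hmeas : Measurable (Function.uncurry (batchField H K)))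
    (μ : ℝ) (θ₀ : EuclideanSpace ℝ (Fin d)) (t : ℕ) :
    ∃ g : (Finset.range (t * K + 1) → 𝓦) → EuclideanSpace ℝ (Fin d), Measurable g ∧
      ∀ ω, stochTraj (batchDir H W K) μ θ₀ t ω = g fun i => W i ω := by
  induction t with
  | zero => exact ⟨fun _ => θ₀, measurable_const, fun _ => rfl⟩
  | succ t ih =>
    obtain ⟨g, hg, hgW⟩ := ih
    have hsub : ∀ i : Finset.range (t * K + 1), (i : ℕ) ∈ Finset.range ((t + 1) * K + 1) := by
      intro i
      have := Finset.mem_range.1 i.2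
      rw [Finset.mem_range, add_mul, one_mul]
      omega
    have hmem : ∀ j : Fin K, (t + 1) * K - (j : ℕ) ∈ Finset.range ((t + 1) * K + 1) := by
      intro j
      rw [Finset.mem_range]
      omega
    set r : (Finset.range ((t + 1) * K + 1) → 𝓦) → (Finset.range (t * K + 1) → 𝓦) :=
      fun w i => w ⟨i, hsub i⟩ with hr
    set s : (Finset.range ((t + 1) * K + 1) → 𝓦) → (Fin K → 𝓦) := fun w j => w ⟨_, hmem j⟩ with hs
    have hrm : Measurable r := measurable_pi_lambda _ fun i => measurable_pi_apply _
    have hsm : Measurable s := measurable_pi_lambda _ fun i => measurable_pi_apply _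
    refine ⟨fun w => g (r w) - μ • batchField H K (s w) (g (r w)), ?_, fun ω => ?_⟩
    · have h1 : Measurable fun w => batchField H K (s w) (g (r w)) :=
        hmeas.comp (hsm.prodMk (hg.comp hrm))
      exact (hg.comp hrm).sub (h1.const_smul μ)
    · rw [stochTraj, batchDir_succ, hgW]
      rfl

lemma measurable_stochTraj (hW : ∀ t, Measurable (W t))
    (hmeas : Measurable (Function.uncurry (batchField H K)))
    (μ : ℝ) (θ₀ : EuclideanSpace ℝ (Fin d)) (t : ℕ) :
    Measurable (stochTraj (batchDir H W K) μ θ₀ t) := by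
  obtain ⟨g, hg, hgW⟩ := exists_stochTraj_eq (W := W) hmeas μ θ₀ t
  rw [funext hgW]
  exact hg.comp (measurable_pi_lambda _ fun i => hW i)

lemma indepFun_stochTraj_batchNoise (hW : ∀ t, Measurable (W t)) (hind : iIndepFun W P)
    (hmeas : Measurable (Function.uncurry (batchField H K)))
    (μ : ℝ) (θ₀ : EuclideanSpace ℝ (Fin d)) (t : ℕ) :
    IndepFun (stochTraj (batchDir H W K) μ θ₀ t) (batchNoise W K t) P := by
  obtain ⟨g, hg, hgW⟩ := exists_stochTraj_eq (W := W) hmeas μ θ₀ t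
  have hdisj : Disjoint (Finset.range (t * K + 1)) (Finset.Ioc (t * K) ((t + 1) * K)) := by
    rw [Finset.disjoint_left]
    intro i hi hi'
    have h1 := Finset.mem_range.1 hi
    have h2 := (Finset.mem_Ioc.1 hi').1
    omega
  have hmem : ∀ j : Fin K, (t + 1) * K - (j : ℕ) ∈ Finset.Ioc (t * K) ((t + 1) * K) := fun j =>
    Finset.mem_Ioc.2 ⟨lt_of_fin_batch t j, Nat.sub_le _ _⟩
  have h := (hind.indepFun_finset _ _ hdisj hW).comp hg
    (measurable_pi_lambda (fun (w : Finset.Ioc (t * K) ((t + 1) * K) → 𝓦) (j : Fin K) =>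
      w ⟨_, hmem j⟩) fun j => measurable_pi_apply _)
  rw [funext hgW]
  exact h

/-- Independence of the state and the next batch makes their joint law a product, which is the
recursion defining `chainLaw`. -/
lemma map_stochTraj (hW : ∀ t, Measurable (W t)) (hlaw : ∀ t, P.map (W t) = ν)
    (hind : iIndepFun W P)
    (h : AttractingField (Measure.pi fun _ : Fin K => ν) (batchField H K) θs L m)
    (μ : ℝ) (θ₀ : EuclideanSpace ℝ (Fin d)) (t : ℕ) :
    P.map (stochTraj (batchDir H W K) μ θ₀ t) =
      chainLaw (Measure.pi fun _ : Fin K => ν) (batchField H K) μ θ₀ t := by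
  induction t with
  | zero =>
    have : stochTraj (batchDir H W K) μ θ₀ 0 = fun _ => θ₀ := rfl
    rw [this, Measure.map_const, measure_univ, one_smul, chainLaw]
  | succ t ih =>
    have hX := measurable_stochTraj hW h.meas μ θ₀ t
    have hξ := measurable_batchNoise hW K t
    have hpair := (indepFun_iff_map_prod_eq_prod_map_map hX.aemeasurable hξ.aemeasurable).1
      (indepFun_stochTraj_batchNoise hW hind h.meas μ θ₀ t)
    rw [ih, map_batchNoise hW hlaw hind] at hpair
    rw [chainLaw, ← hpair, Measure.map_map (h.measurable_step μ) (hX.prodMk hξ)]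
    congr 1
    funext ω
    rw [stochTraj, batchDir_succ]
    rfl

lemma avgTraj_batchDir (hW : ∀ t, Measurable (W t)) (hlaw : ∀ t, P.map (W t) = ν)
    (hind : iIndepFun W P)
    (h : AttractingField (Measure.pi fun _ : Fin K => ν) (batchField H K) θs L m)
    (μ : ℝ) (θ₀ : EuclideanSpace ℝ (Fin d)) (t : ℕ) :
    avgTraj P (batchDir H W K) μ θ₀ t =
      (meanStep (meanField (Measure.pi fun _ : Fin K => ν) (batchField H K)) μ)^[t] θ₀ := by
  induction t with
  | zero => rfl
  | succ t ih =>
    rw [Function.iterate_succ_apply', avgTraj, ih]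
    simp only [batchDir_succ]
    set y := (meanStep (meanField (Measure.pi fun _ : Fin K => ν) (batchField H K)) μ)^[t] θ₀
    rw [meanStep, meanField, ← map_batchNoise hW hlaw hind t,
      integral_map (measurable_batchNoise hW K t).aemeasurable
        (h.measurable_field y).aestronglyMeasurable]

lemma memLp_stochTraj (hW : ∀ t, Measurable (W t)) (hlaw : ∀ t, P.map (W t) = ν)
    (hind : iIndepFun W P)
    (h : AttractingField (Measure.pi fun _ : Fin K => ν) (batchField H K) θs L m)
    (μ : ℝ) (θ₀ : EuclideanSpace ℝ (Fin d)) (t : ℕ) :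
    MemLp (stochTraj (batchDir H W K) μ θ₀ t) 2 P := by
  have h1 := h.memLp_id_chainLaw μ θ₀ t
  rw [← map_stochTraj hW hlaw hind h, memLp_map_measure_iff (by fun_prop)
    (measurable_stochTraj hW h.meas μ θ₀ t).aemeasurable] at h1
  exact h1

/-- Convergence of the perturbation covariance matrices of the batch algorithm. -/
lemma exists_tendsto_secondMoment_perturbation (hW : ∀ t, Measurable (W t))
    (hlaw : ∀ t, P.map (W t) = ν) (hind : iIndepFun W P)
    (h : AttractingField (Measure.pi fun _ : Fin K => ν) (batchField H K) θs L m) :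
    ∃ V : ℝ → Matrix (Fin d) (Fin d) ℝ,
      (∀ᶠ μ in 𝓝[>] (0 : ℝ), ∀ θ₀, Tendsto
        (fun n => secondMoment P (perturbation P (batchDir H W K) μ θ₀ n)) atTop (𝓝 (V μ))) ∧
      ∀ Q, SolvesLyapunov
          (jacobianMatrix (meanField (Measure.pi fun _ : Fin K => ν) (batchField H K)) θs)
          (secondMoment (Measure.pi fun _ : Fin K => ν) (fun ξ => batchField H K ξ θs)) Q →
        Tendsto (fun μ : ℝ => μ⁻¹ • V μ) (𝓝[>] 0) (𝓝 Q) := by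
  obtain ⟨V, hV, hQ⟩ := h.exists_stationary_secondMoment
  refine ⟨V, ?_, hQ⟩
  filter_upwards [hV, self_mem_nhdsWithin,
    eventually_mul_lt (2 * L ^ 2) h.pos] with μ hμV hμ hμL θ₀
  refine (h.tendsto_secondMoment_sub (hμV θ₀)
    (h.tendsto_iterate_meanStep hμ (by linarith) θ₀)).congr fun n => ?_
  ext i j
  simp only [secondMoment, Matrix.of_apply, perturbation]
  rw [← map_stochTraj hW hlaw hind h, avgTraj_batchDir hW hlaw hind h, integral_map
    (measurable_stochTraj hW h.meas μ θ₀ n).aemeasurable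
    (Measurable.aestronglyMeasurable (by fun_prop))]

end Trajectories

end

/-! ### Assembly of the theorem -/

theorem lemma1 {Ω 𝓦 : Type*} [MeasurableSpace Ω] [MeasurableSpace 𝓦] {d : ℕ}
    (P : Measure Ω) [IsProbabilityMeasure P]
    (ν : Measure 𝓦)
    -- the data: independent realizations `W_t` of a random element with law `ν`
    (W : ℕ → Ω → 𝓦)
    (hWmeas : ∀ t, Measurable (W t))
    (hWlaw : ∀ t, P.map (W t) = ν)
    (hWindep : iIndepFun W P)
    -- the loss `h(w, θ)`, with gradient `H(w, θ) = ∇_θ h(w, θ)`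
    (h : 𝓦 → EuclideanSpace ℝ (Fin d) → ℝ)
    (hdiff : ∀ w, Differentiable ℝ (h w))
    (hint : ∀ θ, Integrable (fun w => h w θ) ν)
    (hHmeas : Measurable (fun p : 𝓦 × EuclideanSpace ℝ (Fin d) => stochGrad h p.1 p.2))
    -- finite second moments and mean-square Lipschitz continuity of `H`
    (hHmom : ∀ θ, MemLp (fun w => stochGrad h w θ) 2 ν)
    (L : ℝ)
    (hHlip : ∀ θ θ' : EuclideanSpace ℝ (Fin d),
      ∫ w, ‖stochGrad h w θ - stochGrad h w θ'‖ ^ 2 ∂ν ≤ L ^ 2 * ‖θ - θ'‖ ^ 2)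
    -- the minimizer `θ_*`, near which the mean field is `C¹`, and which attracts it globally
    (θs : EuclideanSpace ℝ (Fin d))
    (hmin : IsLocalMin (fun θ => ∫ w, h w θ ∂ν) θs)
    (hC1 : ContDiffAt ℝ 1 (meanGrad ν h) θs)
    (m : ℝ) (hm : 0 < m)
    (hattr : ∀ θ, m * ‖θ - θs‖ ^ 2 ≤ inner ℝ (meanGrad ν h θ) (θ - θs)) :
    -- all second moments below are finite
    (∀ (μ : ℝ) (θ₀ : EuclideanSpace ℝ (Fin d)) (t : ℕ),
      MemLp (stochTraj (classicalDir (stochGrad h) W) μ θ₀ t) 2 P ∧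
      ∀ K : ℕ, 1 ≤ K → MemLp (stochTraj (batchDir (stochGrad h) W K) μ θ₀ t) 2 P) ∧
    -- average trajectory of the batch algorithm
    (∀ K : ℕ, 1 ≤ K → ∀ (μ' : ℝ) (θ₀ : EuclideanSpace ℝ (Fin d)) (n : ℕ),
      avgTraj P (batchDir (stochGrad h) W K) μ' θ₀ (n + 1) =
        avgTraj P (batchDir (stochGrad h) W K) μ' θ₀ n -
          μ' • meanGrad ν h (avgTraj P (batchDir (stochGrad h) W K) μ' θ₀ n)) ∧
    -- average trajectory of the classical algorithm with step `μ'/K`, subsampled every `K` steps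
    (∃ c : ℝ, ∀ K : ℕ, 1 ≤ K → ∀ μ' : ℝ, 0 < μ' → μ' ≤ 1 →
      ∀ (θ₀ : EuclideanSpace ℝ (Fin d)) (n : ℕ),
        ∃ A : EuclideanSpace ℝ (Fin d) →L[ℝ] EuclideanSpace ℝ (Fin d), ‖A‖ ≤ c * μ' ∧
          avgTraj P (classicalDir (stochGrad h) W) (μ' / K) θ₀ ((n + 1) * K) =
            avgTraj P (classicalDir (stochGrad h) W) (μ' / K) θ₀ (n * K) -
              μ' • (1 + A)
                (meanGrad ν h
                  (avgTraj P (classicalDir (stochGrad h) W) (μ' / K) θ₀ (n * K)))) ∧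
    -- steady-state perturbation covariance matrices
    (∃ Q : Matrix (Fin d) (Fin d) ℝ,
      (SolvesLyapunov (jacobianMatrix (meanGrad ν h) θs)
          (secondMoment ν (fun w => stochGrad h w θs)) Q ∧
        ∀ Q', SolvesLyapunov (jacobianMatrix (meanGrad ν h) θs)
          (secondMoment ν (fun w => stochGrad h w θs)) Q' → Q' = Q) ∧
      ∀ K : ℕ, 1 ≤ K →
        ∃ μ₀ : ℝ, 0 < μ₀ ∧ ∃ V V' : ℝ → Matrix (Fin d) (Fin d) ℝ,
          (∀ μ' : ℝ, 0 < μ' → μ' < μ₀ → ∀ θ₀ : EuclideanSpace ℝ (Fin d),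
            Tendsto (fun t => secondMoment P
              (perturbation P (classicalDir (stochGrad h) W) (μ' / K) θ₀ t))
              atTop (𝓝 (V μ')) ∧
            Tendsto (fun n => secondMoment P
              (perturbation P (batchDir (stochGrad h) W K) μ' θ₀ n))
              atTop (𝓝 (V' μ'))) ∧
          Tendsto (fun μ' : ℝ => (μ' / K)⁻¹ • V μ') (𝓝[>] 0) (𝓝 Q) ∧
          Tendsto (fun μ' : ℝ => (μ' / K)⁻¹ • V' μ') (𝓝[>] 0) (𝓝 Q)) := by
  have hν : IsProbabilityMeasure ν := by
    rw [← hWlaw 0]; exact Measure.isProbabilityMeasure_map (hWmeas 0).aemeasurable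
  have hfield : ∀ K : ℕ, 1 ≤ K → AttractingField (Measure.pi fun _ : Fin K => ν)
      (batchField (stochGrad h) K) θs (max |L| m) m := fun K hK =>
    attractingField_batchField hK hHmeas hHmom hHlip hC1 hm hattr
  have hmean : ∀ K : ℕ, 1 ≤ K →
      meanField (Measure.pi fun _ : Fin K => ν) (batchField (stochGrad h) K) = meanGrad ν h :=
    fun K hK => funext fun θ => meanField_batchField hK hHmom θ
  have havg : ∀ K : ℕ, 1 ≤ K → ∀ (μ : ℝ) (θ₀ : EuclideanSpace ℝ (Fin d)) (t : ℕ),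
      avgTraj P (batchDir (stochGrad h) W K) μ θ₀ t = (meanStep (meanGrad ν h) μ)^[t] θ₀ :=
    fun K hK μ θ₀ t => by
      rw [avgTraj_batchDir hWmeas hWlaw hWindep (hfield K hK), hmean K hK]
  have hzero : ∫ w, stochGrad h w θs ∂ν = 0 := by
    have h1 := (hfield 1 le_rfl).meanField_eq_zero
    rwa [hmean 1 le_rfl] at h1
  have hLm : 0 ≤ max |L| m := (abs_nonneg L).trans (le_max_left _ _)
  rw [classicalDir_eq_batchDir]
  refine ⟨fun μ θ₀ t => ⟨memLp_stochTraj hWmeas hWlaw hWindep (hfield 1 le_rfl) μ θ₀ t,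
    fun K hK => memLp_stochTraj hWmeas hWlaw hWindep (hfield K hK) μ θ₀ t⟩, ?_, ?_, ?_⟩
  · intro K hK μ' θ₀ n
    rw [havg K hK, havg K hK, Function.iterate_succ_apply', meanStep]
  · refine ⟨max |L| m * Real.exp (max |L| m), fun K hK μ' hμ' hμ'1 θ₀ n => ?_⟩
    rw [havg 1 le_rfl, havg 1 le_rfl, add_mul, one_mul, add_comm (n * K), Function.iterate_add_apply]
    have hlip := (hfield 1 le_rfl).norm_meanField_sub_le
    rw [hmean 1 le_rfl] at hlip
    exact exists_iterate_meanStep_eq hLm hlip hK hμ' hμ'1 _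
  · obtain ⟨Q, hQ, hQu⟩ := (hfield 1 le_rfl).exists_solvesLyapunov
      (secondMoment ν (fun w => stochGrad h w θs))
    rw [hmean 1 le_rfl] at hQ hQu
    -- A batch of size `K` has noise `S/K`, so `Q/K` solves its Lyapunov equation; dividing by `μ/K`
    -- instead of `μ` restores `Q`.
    have hlim : ∀ K : ℕ, 1 ≤ K → ∃ V : ℝ → Matrix (Fin d) (Fin d) ℝ,
        (∀ᶠ μ in 𝓝[>] (0 : ℝ), ∀ θ₀, Tendsto (fun n => secondMoment P
          (perturbation P (batchDir (stochGrad h) W K) μ θ₀ n)) atTop (𝓝 (V μ))) ∧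
        Tendsto (fun μ : ℝ => (μ / K)⁻¹ • V μ) (𝓝[>] 0) (𝓝 Q) := by
      intro K hK
      have hK0 : (K : ℝ) ≠ 0 := by positivity
      obtain ⟨V, hV, hVQ⟩ :=
        exists_tendsto_secondMoment_perturbation hWmeas hWlaw hWindep (hfield K hK)
      refine ⟨V, hV, ?_⟩
      have hsol : SolvesLyapunov (jacobianMatrix (meanGrad ν h) θs)
          ((K : ℝ)⁻¹ • secondMoment ν (fun w => stochGrad h w θs)) ((K : ℝ)⁻¹ • Q) := by
        have hQ' := hQ
        unfold SolvesLyapunov at hQ' ⊢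
        rw [Matrix.mul_smul, Matrix.smul_mul, ← smul_add, hQ']
      rw [hmean K hK, secondMoment_batchField hK hHmom hzero] at hVQ
      have h1 := (hVQ _ hsol).const_smul (K : ℝ)
      rw [smul_smul, mul_inv_cancel₀ hK0, one_smul] at h1
      refine h1.congr fun μ => ?_
      rw [smul_smul, inv_div, div_eq_mul_inv]
    refine ⟨Q, ⟨hQ, hQu⟩, fun K hK => ?_⟩
    have hK0 : (0 : ℝ) < K := by positivity
    obtain ⟨V₁, hV₁, hV₁Q⟩ := hlim 1 le_rfl
    obtain ⟨V', hV', hV'Q⟩ := hlim K hK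
    have hscale : Tendsto (fun μ : ℝ => μ / K) (𝓝[>] 0) (𝓝[>] 0) := by
      refine tendsto_nhdsWithin_iff.2 ⟨?_, ?_⟩
      · have : Tendsto (fun μ : ℝ => μ / K) (𝓝 0) (𝓝 (0 / K)) :=
          Continuous.tendsto (by fun_prop) 0
        rw [zero_div] at this
        exact this.mono_left nhdsWithin_le_nhds
      · filter_upwards [self_mem_nhdsWithin] with μ hμ using div_pos hμ hK0
    obtain ⟨μ₀, hμ₀, hsub⟩ := mem_nhdsGT_iff_exists_Ioo_subset.1 ((hscale.eventually hV₁).and hV')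
    -- The classical limit is the one for batch size `1` evaluated at the step `μ'/K`.
    refine ⟨μ₀, hμ₀, fun μ' => V₁ (μ' / K), V', fun μ' hpos hlt θ₀ => ?_, ?_, hV'Q⟩
    · have hμ' := hsub ⟨hpos, hlt⟩
      exact ⟨hμ'.1 θ₀, hμ'.2 θ₀⟩
    · have h1 := hV₁Q.comp hscale
      simpa only [Function.comp_def, Nat.cast_one, div_one] using h1
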